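/- A *parametric event-recording automaton* (PERA) is a tuple $(\Sigma, L, \ell_0, P, I, E)$, where $\Sigma$, $L$, $P$ are finite sets of actions, locations and parameters, $\ell_0\in L$ is the initial location, $I$ assigns to every location a guard (its invariant), and $E$ is a finite set of edges $(\ell,g,a,\ell')$ with $\ell,\ell'\in L$, $a\in\Sigma$ and $g$ a guard. There is one clock $x_a$ for each action $a$; a guard is a finite conjunction of inequalities $x_a\bowtie\eta$ with ${\bowtie}\in\{<,\le,\ge,>\}$ and $\eta$ a parameter or an integer constant. A parameter valuation is a map $v:P\to\mathbb{Q}_{\ge 0}$. Under $v$, a state is a pair $(\ell,w)$, with $w$ a valuation of the clocks in $\mathbb{R}_{\ge 0}$ satisfying $I(\ell)$; the initial state is $(\ell_0,\vec 0)$. A run starts in the initial state and each of its steps consists of a delay $d\ge 0$, during which the invariant holds throughout, followed by an edge $(\ell,g,a,\ell')$ whose guard holds and which resets the clock $x_a$ only. The untimed word of a run is the sequence of the actions of its edges. For a set $F\subseteq L$ of accepting locations, consider the following untimed languages of a PERA $\mathsf{A}$ under a valuation $v$: 1. (Büchi) the infinite words of the infinite runs that pass infinitely often through locations of $F$; 2.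 (reachability) the finite words of the finite runs that end in a location of $F$; 3. (safety) the finite words of all finite runs (no accepting locations are considered). For each of these three notions $\mathsf{UL}$ of language, the *language preservation problem* is undecidable: there is no algorithm that, given a PERA $\mathsf{A}$ (together with $F$ in cases 1 and 2) and a reference valuation $v_0$, decides whether there is a valuation $v\neq v_0$ with $\mathsf{UL}(v(\mathsf{A}))=\mathsf{UL}(v_0(\mathsf{A}))$. -/

import Mathlib

open scoped NNReal NNRat

/-! Parametric event-recording automata (PERAs) over a set `Act` of actions, a set `Loc` of
locations and a set `Par` of parameters. There is one clock per action, so clocks are named by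
`Act`. -/
namespace PERA

/-- The comparison operators `<`, `≤`, `≥`, `>`. -/
inductive Rel where
  | lt | le | ge | gt

/-- The comparison of real numbers that an operator denotes. -/
def Rel.holds : Rel → ℝ → ℝ → Prop
  | .lt, x, y => x < y
  | .le, x, y => x ≤ y
  | .ge, x, y => x ≥ y
  | .gt, x, y => x > y

/-- An inequality `clock ⋈ η`, where `η` is a parameter or an integer constant. -/
structure Atom (Act Par : Type) where
  clock : Act
  rel : Rel
  bound : Par ⊕ ℤ

/-- A guard is a finite conjunction of inequalities (the empty list is `true`). -/
abbrev Guard (Act Par : Type) := List (Atom Act Par)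

/-- An edge `(src, guard, act, tgt)`. -/
structure Edge (Act Loc Par : Type) where
  src : Loc
  guard : Guard Act Par
  act : Act
  tgt : Loc

/-- A parameter valuation, with non-negative rational values. -/
abbrev ParamVal (Par : Type) := Par → ℚ≥0

/-- A clock valuation, with non-negative real values. -/
abbrev ClockVal (Act : Type) := Act → ℝ≥0

/-- The value of a right-hand side under a parameter valuation. -/
def boundVal {Par : Type} (v : ParamVal Par) : Par ⊕ ℤ → ℝ
  | .inl p => ((v p : ℚ) : ℝ)
  | .inr z => (z : ℝ)

/-- The clock valuation `w` satisfies the guard `g` in which the parameters have been replaced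
by their values under `v`. -/
def Guard.Sat {Act Par : Type} (v : ParamVal Par) (w : ClockVal Act) (g : Guard Act Par) : Prop :=
  ∀ c ∈ g, c.rel.holds (w c.clock : ℝ) (boundVal v c.bound)

end PERA

/-- A parametric event-recording automaton. The finite set of edges is given by a list. -/
structure PERA (Act Loc Par : Type) where
  init : Loc
  inv : Loc → PERA.Guard Act Par
  edges : List (PERA.Edge Act Loc Par)

namespace PERA

section Semantics

variable {Act Loc Par : Type}

/-- The states of the timed transition system: the clocks satisfy the invariant. -/
def IsState (A : PERA Act Loc Par) (v : ParamVal Par) (s : Loc × ClockVal Act) : Prop :=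
  Guard.Sat v s.2 (A.inv s.1)

/-- Delay transitions `(l, w) → (l, w + d)`. -/
def DelayStep (A : PERA Act Loc Par) (v : ParamVal Par) (s : Loc × ClockVal Act) (d : ℝ≥0)
    (s' : Loc × ClockVal Act) : Prop :=
  s' = (s.1, fun x => s.2 x + d) ∧ ∀ d' : ℝ≥0, d' ≤ d → A.IsState v (s.1, fun x => s.2 x + d')

open Classical in
/-- Discrete transitions; the clock of the action of the edge is reset. -/
def DiscreteStep (A : PERA Act Loc Par) (v : ParamVal Par) (s : Loc × ClockVal Act)
    (e : Edge Act Loc Par) (s' : Loc × ClockVal Act) : Prop :=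
  A.IsState v s ∧ A.IsState v s' ∧ e ∈ A.edges ∧ s.1 = e.src ∧ s'.1 = e.tgt ∧
    s'.2 = Function.update s.2 e.act 0 ∧ Guard.Sat v s.2 e.guard

/-- A step of a run: a delay followed by a discrete transition. -/
def Step (A : PERA Act Loc Par) (v : ParamVal Par) (s : Loc × ClockVal Act) (d : ℝ≥0)
    (e : Edge Act Loc Par) (s' : Loc × ClockVal Act) : Prop :=
  ∃ m, A.DelayStep v s d m ∧ A.DiscreteStep v m e s'

/-- The initial state. -/
def initState (A : PERA Act Loc Par) : Loc × ClockVal Act := (A.init, fun _ => 0)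

/-- `A.FinRun v u s`: some finite run from the initial state has the untimed word `u` and ends
in the state `s`. -/
inductive FinRun (A : PERA Act Loc Par) (v : ParamVal Par) :
    List Act → Loc × ClockVal Act → Prop where
  | start : A.IsState v A.initState → FinRun A v [] A.initState
  | snoc {u : List Act} {s s' : Loc × ClockVal Act} {d : ℝ≥0} {e : Edge Act Loc Par} :
      FinRun A v u s → A.Step v s d e s' → FinRun A v (u ++ [e.act]) s'

/-- `s 0, (d 0, e 0), s 1, (d 1, e 1), …` is an infinite run from the initial state. -/
def IsInfRun (A : PERA Act Loc Par) (v : ParamVal Par) (s : ℕ → Loc × ClockVal Act)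
    (d : ℕ → ℝ≥0) (e : ℕ → Edge Act Loc Par) : Prop :=
  s 0 = A.initState ∧ ∀ i, A.Step v (s i) (d i) (e i) (s (i + 1))

/-- Büchi untimed language: the words of the runs that pass infinitely often through an accepting
location. -/
def buchiLang (A : PERA Act Loc Par) (F : List Loc) (v : ParamVal Par) : Set (ℕ → Act) :=
  {u | ∃ s d e, A.IsInfRun v s d e ∧ (∀ i, u i = (e i).act) ∧ {i | (s i).1 ∈ F}.Infinite}

/-- Reachability untimed language: the words of the finite runs that end in an accepting
location. -/
def reachLang (A : PERA Act Loc Par) (F : List Loc) (v : ParamVal Par) : Set (List Act) :=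
  {u | ∃ s, A.FinRun v u s ∧ s.1 ∈ F}

/-- Safety untimed language: the words of all finite runs. -/
def safetyLang (A : PERA Act Loc Par) (v : ParamVal Par) : Set (List Act) :=
  {u | ∃ s, A.FinRun v u s}

end Semantics

/-- Some valuation other than `v₀` gives the same language as `v₀`. -/
def Preserved {Par W : Type} (UL : ParamVal Par → Set W) (v₀ : ParamVal Par) : Prop :=
  ∃ v, v ≠ v₀ ∧ UL v = UL v₀

/-! Finite descriptions of automata, as inputs of algorithms. Up to renaming, the finite sets of
actions, locations and parameters are `Fin n`, `Fin m` and `Fin k`. -/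
section Codes

variable {n m k : ℕ}

abbrev GuardCode := List (ℕ × ℕ × (ℕ ⊕ ℤ))

/-- Numbers of actions, locations and parameters; initial location; invariants; edges. -/
abbrev AutCode :=
  (ℕ × ℕ × ℕ) × ℕ × List GuardCode × List (ℕ × GuardCode × ℕ × ℕ)

def Rel.code : Rel → ℕ
  | .lt => 0
  | .le => 1
  | .ge => 2
  | .gt => 3

def Guard.code (g : Guard (Fin n) (Fin k)) : GuardCode :=
  g.map fun c => (c.clock.val, c.rel.code, c.bound.map Fin.val id)

def Edge.code (e : Edge (Fin n) (Fin m) (Fin k)) : ℕ × GuardCode × ℕ × ℕ :=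
  (e.src.val, Guard.code e.guard, e.act.val, e.tgt.val)

def code (A : PERA (Fin n) (Fin m) (Fin k)) : AutCode :=
  ((n, m, k), A.init.val, List.ofFn fun l => Guard.code (A.inv l), A.edges.map Edge.code)

/-- A valuation is described by the list of the numerators and denominators of its values. -/
def valCode (v : ParamVal (Fin k)) : List (ℕ × ℕ) :=
  List.ofFn fun p => ((v p).num, (v p).den)

/-! Descriptions determine the automaton and the valuation. -/

theorem Atom.code_injective : Function.Injective
    (fun c : Atom (Fin n) (Fin k) => (c.clock.val, c.rel.code, c.bound.map Fin.val id)) := by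
  rintro ⟨a, r, b⟩ ⟨a', r', b'⟩ h
  simp only [Prod.mk.injEq] at h
  obtain ⟨h1, h2, h3⟩ := h
  have hb := Sum.map_injective.2 ⟨Fin.val_injective, Function.injective_id⟩ h3
  have hr : r = r' := by cases r <;> cases r' <;> first | rfl | (simp [Rel.code] at h2)
  rw [Fin.ext h1, hr, hb]

theorem Guard.code_injective : Function.Injective (Guard.code (n := n) (k := k)) :=
  List.map_injective_iff.2 Atom.code_injective

theorem Edge.code_injective : Function.Injective (Edge.code (n := n) (m := m) (k := k)) := by
  rintro ⟨a, g, b, c⟩ ⟨a', g', b', c'⟩ h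
  simp only [Edge.code, Prod.mk.injEq] at h
  obtain ⟨h1, h2, h3, h4⟩ := h
  rw [Fin.ext h1, Guard.code_injective h2, Fin.ext h3, Fin.ext h4]

theorem code_injective : Function.Injective (code (n := n) (m := m) (k := k)) := by
  rintro ⟨i, I, E⟩ ⟨i', I', E'⟩ h
  simp only [code, Prod.mk.injEq] at h
  obtain ⟨-, h1, h2, h3⟩ := h
  have hI : I = I' := by
    funext l
    exact Guard.code_injective (congrFun (List.ofFn_injective h2) l)
  rw [Fin.ext h1, hI, List.map_injective_iff.2 Edge.code_injective h3]

theorem valCode_injective : Function.Injective (valCode (k := k)) := by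
  intro v v' h
  funext p
  have := congrFun (List.ofFn_injective h) p
  simp only [Prod.mk.injEq] at this
  exact NNRat.ext_num_den this.1 this.2

end Codes

/-- A decision problem about a PERA and a parameter valuation is decidable: some algorithm answers
it correctly on all descriptions of such inputs. -/
def DecidableProblem
    (Q : ∀ n m k : ℕ, PERA (Fin n) (Fin m) (Fin k) → ParamVal (Fin k) → Prop) : Prop :=
  ∃ D : AutCode × List (ℕ × ℕ) → Prop, ComputablePred D ∧
    ∀ (n m k : ℕ) (A : PERA (Fin n) (Fin m) (Fin k)) (v₀ : ParamVal (Fin k)),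
      D (A.code, valCode v₀) ↔ Q n m k A v₀

/-- A decision problem about a PERA, a set of accepting locations (given by a list) and a parameter
valuation is decidable. -/
def DecidableProblemAcc
    (Q : ∀ n m k : ℕ, PERA (Fin n) (Fin m) (Fin k) → List (Fin m) → ParamVal (Fin k) → Prop) :
    Prop :=
  ∃ D : AutCode × List ℕ × List (ℕ × ℕ) → Prop, ComputablePred D ∧
    ∀ (n m k : ℕ) (A : PERA (Fin n) (Fin m) (Fin k)) (F : List (Fin m)) (v₀ : ParamVal (Fin k)),
      D (A.code, F.map Fin.val, valCode v₀) ↔ Q n m k A F v₀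

end PERA

/-! The halting problem is reduced to language preservation with one parameter `p` and reference
valuation `p = 0`. For a given code, a register machine searches for a halting time: it halts if
there is one, and otherwise increments its counter without bound.

The automaton simulates this machine in time windows of length `p`. The clock of `tick` measures the
time since the window began, and a register holds the number `m` when its clock is reset at time `m`
of the window. An untouched register is reset again when its clock equals `p`, hence at the same
time of the next window. Copying resets the target when the source clock equals `p`; an increment
resets the clock once more when it equals `1`; a test compares two clocks at a reset time. All of
this resets only the clock of the action that is read. If an increment would reach a value `≥ p`, or
the input is `≥ p > 0`, an edge labelled `err` leads to the error location.

A separate component reads every word without `err`, and `err` is read only when entering the error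
location. So each of the three languages consists of all words without `err` exactly if the error is
unreachable. For `p = 0` no edge from the initial location into the simulation or to the error is
enabled. Hence the language is preserved iff some `p > 0` avoids the error, iff the numbers of the
computation stay bounded, iff the machine halts. Soundness of the simulation is the invariant in
`Sim.Inv.step`, completeness is `Sim.canStart_of_reach`, and `exists_reduction` assembles the
argument. -/

namespace RegMachine

/-! ### Structured register programs compute all primitive recursive functions. -/

/-- Structured programs on registers named by natural numbers; `loop i j P` repeats `P` as long as
the registers `i` and `j` differ. -/
inductive Prog where
  | zero (j : ℕ)
  | succ (i : ℕ)
  | copy (i j : ℕ)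
  | seq (P Q : Prog)
  | loop (i j : ℕ) (P : Prog)

/-- Big-step semantics of programs. -/
inductive Exec : Prog → (ℕ → ℕ) → (ℕ → ℕ) → Prop where
  | zero (j : ℕ) (σ : ℕ → ℕ) : Exec (.zero j) σ (Function.update σ j 0)
  | succ (i : ℕ) (σ : ℕ → ℕ) : Exec (.succ i) σ (Function.update σ i (σ i + 1))
  | copy (i j : ℕ) (σ : ℕ → ℕ) : Exec (.copy i j) σ (Function.update σ j (σ i))
  | seq {P Q : Prog} {σ σ' σ'' : ℕ → ℕ} : Exec P σ σ' → Exec Q σ' σ'' → Exec (.seq P Q) σ σ''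
  | loop_done {i j : ℕ} {P : Prog} {σ : ℕ → ℕ} : σ i = σ j → Exec (.loop i j P) σ σ
  | loop_step {i j : ℕ} {P : Prog} {σ σ' σ'' : ℕ → ℕ} : σ i ≠ σ j → Exec P σ σ' →
      Exec (.loop i j P) σ' σ'' → Exec (.loop i j P) σ σ''

/-- `f` is computed by programs that read their arguments in given registers, write the value into
a given register and, apart from that, only change registers from a given one on. -/
def Computes {n : ℕ} (f : List.Vector ℕ n → ℕ) : Prop :=
  ∀ (idx : Fin n → ℕ) (out r : ℕ), (∀ i, idx i < r) → ∃ P, ∀ σ, ∃ σ', Exec P σ σ' ∧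
    σ' out = f (List.Vector.ofFn fun i => σ (idx i)) ∧ ∀ k < r, k ≠ out → σ' k = σ k

theorem Computes.exec_all {m n : ℕ} {g : Fin m → List.Vector ℕ n → ℕ}
    (hg : ∀ i, Computes (g i)) (idx : Fin n → ℕ) (r : ℕ) (hr : ∀ i, idx i < r) (l : ℕ)
    (hl : l ≤ m) : ∃ P, ∀ σ, ∃ σ', Exec P σ σ' ∧
      (∀ i : Fin m, i.val < l → σ' (r + i) = g i (List.Vector.ofFn fun i => σ (idx i))) ∧
      ∀ k < r, σ' k = σ k := by
  induction l with
  | zero =>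
    -- A loop comparing a register with itself does nothing.
    exact ⟨.loop 0 0 (.zero 0), fun σ => ⟨σ, .loop_done rfl, fun i hi => absurd hi (by simp),
      fun _ _ => rfl⟩⟩
  | succ l ih =>
    obtain ⟨P, hP⟩ := ih (by omega)
    obtain ⟨Q, hQ⟩ := hg ⟨l, hl⟩ idx (r + l) (r + m) fun i => (hr i).trans_le (by omega)
    refine ⟨.seq P Q, fun σ => ?_⟩
    obtain ⟨σ₁, h1, h2, h3⟩ := hP σ
    obtain ⟨σ₂, h4, h5, h6⟩ := hQ σ₁
    have hσ : (fun i => σ₁ (idx i)) = fun i => σ (idx i) := funext fun i => h3 _ (hr i)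
    refine ⟨σ₂, .seq h1 h4, fun i hi => ?_, fun k hk => ?_⟩
    · rcases Nat.lt_succ_iff_lt_or_eq.1 hi with hi | hi
      · rw [h6 _ (by omega) (by omega), h2 i hi]
      · obtain rfl : i = ⟨l, hl⟩ := Fin.ext hi
        rw [h5, hσ]
    · rw [h6 k (by omega) (by omega), h3 k hk]

/-- Register `r` is the counter, `r + 1` the accumulator, and scratch space starts at `r + 2`. The
result reaches `out` only at the end, because `out` may be an argument register that the loop still
reads. -/
theorem Computes.prec {n : ℕ} {f : List.Vector ℕ n → ℕ} {g : List.Vector ℕ (n + 2) → ℕ}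
    (hf : Computes f) (hg : Computes g) :
    Computes fun v : List.Vector ℕ (n + 1) =>
      v.head.rec (f v.tail) fun y IH => g (y ::ᵥ IH ::ᵥ v.tail) := by
  intro idx out r hr
  obtain ⟨P, hP⟩ := hf (fun i => idx i.succ) (r + 1) (r + 2) fun i => (hr _).trans_le (by omega)
  obtain ⟨Q, hQ⟩ := hg (Fin.cons r (Fin.cons (r + 1) fun i => idx i.succ)) (r + 1) (r + 2) (by
    intro i
    refine Fin.cases ?_ (fun i => Fin.cases ?_ (fun i => ?_) i) i
    · simp
    · simp
    · simpa using (hr i.succ).trans_le (by omega))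
  have body : ∀ σ, ∃ σ', Exec (.seq Q (.succ r)) σ σ' ∧ σ' r = σ r + 1 ∧
      σ' (r + 1) = g (σ r ::ᵥ σ (r + 1) ::ᵥ List.Vector.ofFn fun i => σ (idx i.succ)) ∧
      ∀ k < r, σ' k = σ k := by
    intro σ
    obtain ⟨σ₁, h1, h2, h3⟩ := hQ σ
    refine ⟨_, .seq h1 (.succ r σ₁), ?_, ?_, fun k hk => ?_⟩
    · simp [h3 r (by omega) (by omega)]
    · rw [Function.update_of_ne (by omega), h2]
      simp [List.Vector.ofFn]
    · rw [Function.update_of_ne hk.ne, h3 k (by omega) (by omega)]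
  have iter : ∀ (d : ℕ) (σ : ℕ → ℕ), σ r + d = σ (idx 0) →
      σ (r + 1) = (σ r).rec (f (List.Vector.ofFn fun i => σ (idx i.succ)))
        (fun y IH => g (y ::ᵥ IH ::ᵥ List.Vector.ofFn fun i => σ (idx i.succ))) →
      ∃ σ', Exec (.loop r (idx 0) (.seq Q (.succ r))) σ σ' ∧
        σ' (r + 1) = (σ (idx 0)).rec (f (List.Vector.ofFn fun i => σ (idx i.succ)))
          (fun y IH => g (y ::ᵥ IH ::ᵥ List.Vector.ofFn fun i => σ (idx i.succ))) ∧
        ∀ k < r, σ' k = σ k := by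
    intro d
    induction d with
    | zero =>
      intro σ hd hσ
      refine ⟨σ, .loop_done (by simpa using hd), ?_, fun _ _ => rfl⟩
      rw [hσ, show σ (idx 0) = σ r by simpa using hd.symm]
    | succ d ih =>
      intro σ hd hσ
      obtain ⟨σ₁, h1, h2, h3, h4⟩ := body σ
      have e0 : σ₁ (idx 0) = σ (idx 0) := h4 _ (hr 0)
      have es : (fun i : Fin n => σ₁ (idx i.succ)) = fun i => σ (idx i.succ) :=
        funext fun i => h4 _ (hr _)
      obtain ⟨σ₂, h5, h6, h7⟩ := ih σ₁ (by omega) (by rw [h3, h2, es, hσ])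
      exact ⟨σ₂, .loop_step (by omega) h1 h5, by rw [h6, e0, es],
        fun k hk => (h7 k hk).trans (h4 k hk)⟩
  refine ⟨.seq (.seq (.seq P (.zero r)) (.loop r (idx 0) (.seq Q (.succ r)))) (.copy (r + 1) out),
    fun σ => ?_⟩
  obtain ⟨σ₁, h1, h2, h3⟩ := hP σ
  have hσ₁ : ∀ k < r, Function.update σ₁ r 0 k = σ k := fun k hk => by
    rw [Function.update_of_ne hk.ne, h3 k (by omega) (by omega)]
  have es : (fun i : Fin n => Function.update σ₁ r 0 (idx i.succ)) = fun i => σ (idx i.succ) :=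
    funext fun i => hσ₁ _ (hr _)
  obtain ⟨σ₂, h4, h5, h6⟩ := iter (σ (idx 0)) (Function.update σ₁ r 0)
    (by simp [hσ₁ _ (hr 0)]) (by rw [es]; simpa using h2)
  refine ⟨_, .seq (.seq (.seq h1 (.zero r σ₁)) h4) (.copy _ _ _), ?_, fun k hk hko => ?_⟩
  · rw [Function.update_self, h5, es, hσ₁ _ (hr 0)]
    simp [List.Vector.ofFn]
  · rw [Function.update_of_ne hko, h6 k hk, hσ₁ k hk]

theorem computes_of_primrec' {n : ℕ} {f : List.Vector ℕ n → ℕ} (hf : Nat.Primrec' f) :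
    Computes f := by
  induction hf with
  | zero =>
    intro idx out r hr
    exact ⟨.zero out, fun σ => ⟨_, .zero _ _, by simp, fun k _ hk => by simp [hk]⟩⟩
  | succ =>
    intro idx out r hr
    refine ⟨.seq (.copy (idx 0) out) (.succ out), fun σ => ⟨_, .seq (.copy _ _ _) (.succ _ _), ?_,
      fun k _ hk => by simp [hk]⟩⟩
    simp [List.Vector.ofFn]
  | get i =>
    intro idx out r hr
    exact ⟨.copy (idx i) out, fun σ => ⟨_, .copy _ _ _, by simp, fun k _ hk => by simp [hk]⟩⟩
  | @comp n m f g _ _ ihf ihg =>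
    intro idx out r hr
    obtain ⟨P, hP⟩ := Computes.exec_all ihg idx r hr _ le_rfl
    obtain ⟨Q, hQ⟩ := ihf (fun i => r + i) out (r + m) (by simp)
    refine ⟨.seq P Q, fun σ => ?_⟩
    obtain ⟨σ₁, h1, h2, h3⟩ := hP σ
    obtain ⟨σ₂, h4, h5, h6⟩ := hQ σ₁
    refine ⟨σ₂, .seq h1 h4, ?_, fun k hk hko => ?_⟩
    · rw [h5]
      congr 2
      exact funext fun i => h2 i i.2
    · rw [h6 k (by omega) hko, h3 k hk]
  | prec _ _ ihf ihg => exact ihf.prec ihg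

/-! ### Register machines and the compilation of programs. -/

/-- Instructions of register machines with states in `Q` and registers in `R`; the instructions
name the next state, and `test i j q q'` goes to `q` if the registers `i` and `j` are equal and to
`q'` otherwise. -/
inductive Instr (Q R : Type) where
  | zero (j : R) (q : Q)
  | succ (i : R) (q : Q)
  | copy (i j : R) (q : Q)
  | test (i j : R) (q q' : Q)

section Machine

variable {Q R : Type} [DecidableEq R]

/-- Transitions of a register machine. In a state without instruction, it halts. -/
inductive Step (M : Q → Option (Instr Q R)) : Q × (R → ℕ) → Q × (R → ℕ) → Prop where
  | zero {q q' : Q} {j : R} {σ : R → ℕ} : M q = some (.zero j q') →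
      Step M (q, σ) (q', Function.update σ j 0)
  | succ {q q' : Q} {i : R} {σ : R → ℕ} : M q = some (.succ i q') →
      Step M (q, σ) (q', Function.update σ i (σ i + 1))
  | copy {q q' : Q} {i j : R} {σ : R → ℕ} : M q = some (.copy i j q') →
      Step M (q, σ) (q', Function.update σ j (σ i))
  | test_eq {q q₁ q₂ : Q} {i j : R} {σ : R → ℕ} : M q = some (.test i j q₁ q₂) → σ i = σ j →
      Step M (q, σ) (q₁, σ)
  | test_ne {q q₁ q₂ : Q} {i j : R} {σ : R → ℕ} : M q = some (.test i j q₁ q₂) → σ i ≠ σ j →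
      Step M (q, σ) (q₂, σ)

/-- Reachability between configurations. -/
abbrev Reach (M : Q → Option (Instr Q R)) : Q × (R → ℕ) → Q × (R → ℕ) → Prop :=
  Relation.ReflTransGen (Step M)

theorem Step.deterministic {M : Q → Option (Instr Q R)} {c c₁ c₂ : Q × (R → ℕ)}
    (h₁ : Step M c c₁) (h₂ : Step M c c₂) : c₁ = c₂ := by
  cases h₁ <;> cases h₂ <;> simp_all

theorem Step.ne_none {M : Q → Option (Instr Q R)} {c c' : Q × (R → ℕ)} (h : Step M c c') :
    M c.1 ≠ none := by
  cases h <;> simp_all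

/-- A halting computation is finite. -/
theorem Reach.finite {M : Q → Option (Instr Q R)} {c c' : Q × (R → ℕ)} (h : Reach M c c')
    (hc' : M c'.1 = none) : {d | Reach M c d}.Finite := by
  induction h using Relation.ReflTransGen.head_induction_on with
  | refl =>
    refine (Set.finite_singleton c').subset fun d hd => ?_
    rcases hd.cases_head with rfl | ⟨e, he, -⟩
    · rfl
    · exact absurd hc' he.ne_none
  | @head c _ h₁ _ ih =>
    refine (ih.insert c).subset fun d hd => ?_
    rcases hd.cases_head with rfl | ⟨e, he, hd⟩
    · exact Set.mem_insert _ _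
    · exact Set.mem_insert_of_mem _ (by rwa [Set.mem_ofPred_eq, h₁.deterministic he])

end Machine

/-- Number of instructions of the code of a program. -/
def Prog.length : Prog → ℕ
  | .zero _ => 1
  | .succ _ => 1
  | .copy _ _ => 1
  | .seq P Q => P.length + Q.length
  | .loop _ _ P => P.length + 2

/-- The code of a program that is stored from the address `a` on. -/
def Prog.compile : Prog → ℕ → List (Instr ℕ ℕ)
  | .zero j, a => [.zero j (a + 1)]
  | .succ i, a => [.succ i (a + 1)]
  | .copy i j, a => [.copy i j (a + 1)]
  | .seq P Q, a => P.compile a ++ Q.compile (a + P.length)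
  | .loop i j P, a => .test i j (a + P.length + 2) (a + 1) :: (P.compile (a + 1) ++ [.test 0 0 a a])

theorem Prog.length_compile (P : Prog) (a : ℕ) : (P.compile a).length = P.length := by
  induction P generalizing a <;> simp_all [Prog.compile, Prog.length]

theorem Exec.reach {P : Prog} {σ σ' : ℕ → ℕ} (h : Exec P σ σ') (C l₁ l₂ : List (Instr ℕ ℕ))
    (hC : C = l₁ ++ P.compile l₁.length ++ l₂) :
    Reach (fun q => C[q]?) (l₁.length, σ) (l₁.length + P.length, σ') := by
  induction h generalizing l₁ l₂ with
  | zero j σ => exact .single (.zero (by simp [hC, Prog.compile, Prog.length]))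
  | succ i σ => exact .single (.succ (by simp [hC, Prog.compile, Prog.length]))
  | copy i j σ => exact .single (.copy (by simp [hC, Prog.compile, Prog.length]))
  | @seq P Q _ _ _ _ _ ih₁ ih₂ =>
    have h₁ := ih₁ l₁ (Q.compile (l₁.length + P.length) ++ l₂) (by simp [hC, Prog.compile])
    have h₂ := ih₂ (l₁ ++ P.compile l₁.length) l₂ (by simp [hC, Prog.compile, Prog.length_compile])
    rw [List.length_append, Prog.length_compile] at h₂
    simpa [Prog.length, Nat.add_assoc] using h₁.trans h₂
  | loop_done h =>
    exact .single (.test_eq (q₂ := l₁.length + 1)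
      (by simp [hC, Prog.compile, Prog.length, Nat.add_assoc]) h)
  | @loop_step i j P σ σ₁ σ₂ h _ _ ih₁ ih₂ =>
    have h₁ := ih₁ (l₁ ++ [.test i j (l₁.length + P.length + 2) (l₁.length + 1)])
      (.test 0 0 l₁.length l₁.length :: l₂) (by simp [hC, Prog.compile])
    rw [List.length_append, List.length_singleton] at h₁
    -- The closing `test 0 0` always succeeds and serves as the jump back to the loop head.
    refine (Relation.ReflTransGen.head (.test_ne (i := i) (j := j) 
      (q₁ := l₁.length + P.length + 2) (by simp [hC, Prog.compile]) h)
      h₁).trans (.head (.test_eq (i := 0) (j := 0) (q₂ := l₁.length) ?_ rfl) (ih₂ l₁ l₂ hC))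
    have := Prog.length_compile P (l₁.length + 1)
    rw [hC, List.append_assoc, List.getElem?_append_right (by omega)]
    simp [Prog.compile, Nat.add_assoc, Nat.add_comm 1, this]

/-! ### Renaming of states and registers. -/

section Map

variable {Q R Q' R' : Type}

/-- Renaming of the states and registers in an instruction. -/
def Instr.map (f : Q → Q') (g : R → R') : Instr Q R → Instr Q' R'
  | .zero j q => .zero (g j) (f q)
  | .succ i q => .succ (g i) (f q)
  | .copy i j q => .copy (g i) (g j) (f q)
  | .test i j q q' => .test (g i) (g j) (f q) (f q')

/-- The registers in an instruction. -/
def Instr.regs : Instr Q R → List R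
  | .zero j _ => [j]
  | .succ i _ => [i]
  | .copy i j _ => [i, j]
  | .test i j _ _ => [i, j]

variable [DecidableEq R] [DecidableEq R'] {M : Q → Option (Instr Q R)}
  {M' : Q' → Option (Instr Q' R')} {f : Q → Q'} {g : R → R'} {h : R' → R}

/-- The renamed machine sees the registers as `σ ∘ h`. The two conditions on `g` and `h` make them
inverse to each other on the registers that occur in instructions, so updates commute with the
renaming. -/
theorem Step.map (hM : ∀ q, M' (f q) = (M q).map (Instr.map f g)) (hgh : Function.LeftInverse g h)
    (hhg : ∀ q I, M q = some I → ∀ i ∈ I.regs, h (g i) = i) {c c' : Q × (R → ℕ)}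
    (hs : Step M c c') : Step M' (f c.1, c.2 ∘ h) (f c'.1, c'.2 ∘ h) := by
  have upd : ∀ (σ : R → ℕ) (j : R) (x : ℕ), h (g j) = j →
      Function.update σ j x ∘ h = Function.update (σ ∘ h) (g j) x := by
    intro σ j x hj
    conv_lhs => rw [← hj]
    exact Function.update_comp_eq_of_injective _ hgh.injective _ _
  cases hs with
  | zero hq =>
    have hj := hhg _ _ hq _ (List.mem_singleton.2 rfl)
    simpa only [upd _ _ _ hj] using Step.zero (M := M') (by rw [hM, hq]; rfl)
  | @succ _ _ i σ hq =>
    have hj := hhg _ _ hq _ (List.mem_singleton.2 rfl)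
    have := Step.succ (M := M') (σ := σ ∘ h) (by rw [hM, hq]; rfl)
    simpa only [upd _ _ _ hj, Function.comp_apply, hj] using this
  | @copy _ _ i j σ hq =>
    have hi := hhg _ _ hq i (by simp [Instr.regs])
    have hj := hhg _ _ hq j (by simp [Instr.regs])
    have := Step.copy (M := M') (σ := σ ∘ h) (by rw [hM, hq]; rfl)
    simpa only [upd _ _ _ hj, Function.comp_apply, hi] using this
  | @test_eq _ _ _ i j σ hq he =>
    have hi := hhg _ _ hq i (by simp [Instr.regs])
    have hj := hhg _ _ hq j (by simp [Instr.regs])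
    exact Step.test_eq (by rw [hM, hq]; rfl) (by simpa only [Function.comp_apply, hi, hj] using he)
  | @test_ne _ _ _ i j σ hq he =>
    have hi := hhg _ _ hq i (by simp [Instr.regs])
    have hj := hhg _ _ hq j (by simp [Instr.regs])
    exact Step.test_ne (by rw [hM, hq]; rfl) (by simpa only [Function.comp_apply, hi, hj] using he)

theorem Reach.map (hM : ∀ q, M' (f q) = (M q).map (Instr.map f g))
    (hgh : Function.LeftInverse g h)
    (hhg : ∀ q I, M q = some I → ∀ i ∈ I.regs, h (g i) = i) {c c' : Q × (R → ℕ)}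
    (hs : Reach M c c') : Reach M' (f c.1, c.2 ∘ h) (f c'.1, c'.2 ∘ h) :=
  Relation.ReflTransGen.lift (fun c : Q × (R → ℕ) => (f c.1, c.2 ∘ h))
    (fun _ _ hs => Step.map hM hgh hhg hs) _ _ hs

end Map

/-! ### Unbounded search by a finite machine. -/

/-- The machine halts when it is started in the configuration `c`. -/
def Halts {Q R : Type} [DecidableEq R] (M : Q → Option (Instr Q R)) (c : Q × (R → ℕ)) : Prop :=
  ∃ c', Reach M c c' ∧ M c'.1 = none

/-- The computation from `c` increments arbitrarily large numbers. -/
def Unbounded {Q R : Type} [DecidableEq R] (M : Q → Option (Instr Q R)) (c : Q × (R → ℕ)) :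
    Prop :=
  ∀ p : ℕ, ∃ q σ i q', Reach M c (q, σ) ∧ M q = some (.succ i q') ∧ p ≤ σ i

/-- The search for a zero of a primitive recursive function by a register machine. -/
theorem exists_search_program {T : ℕ → ℕ → ℕ} (hT : Primrec₂ T) :
    ∃ C : List (Instr ℕ ℕ), ∀ n,
      ((∃ k, T n k = 0) → Halts (fun q => C[q]?) (0, Pi.single 0 n)) ∧
      ((∀ k, T n k ≠ 0) → Unbounded (fun q => C[q]?) (0, Pi.single 0 n)) := by
  -- Register `0` holds the input, `1` the candidate `k`, `2` receives `T n k`, and `3` stays zero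
  -- for comparison; scratch space starts at `4`.
  obtain ⟨P, hP⟩ := computes_of_primrec' (Nat.Primrec'.prim_iff₂.2 hT) (fun i => i.val) 2 4
    fun i => by omega
  have hP' : ∀ σ, ∃ σ', Exec P σ σ' ∧ σ' 2 = T (σ 0) (σ 1) ∧ σ' 0 = σ 0 ∧ σ' 1 = σ 1 ∧
      σ' 3 = σ 3 := by
    intro σ
    obtain ⟨σ', h1, h2, h3⟩ := hP σ
    exact ⟨σ', h1, by simpa [List.Vector.ofFn] using h2, h3 0 (by omega) (by omega),
      h3 1 (by omega) (by omega), h3 3 (by omega) (by omega)⟩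
  set l := P.length
  set C : List (Instr ℕ ℕ) :=
    P.compile 0 ++ [.test 2 3 (l + 3) (l + 1), .succ 1 (l + 2), .test 0 0 0 0] with hC
  have hlen : (P.compile 0).length = l := P.length_compile 0
  have h0 : C[l]? = some (.test 2 3 (l + 3) (l + 1)) := by
    rw [hC, List.getElem?_append_right (by omega)]; simp [hlen]
  have h1 : C[l + 1]? = some (.succ 1 (l + 2)) := by
    rw [hC, List.getElem?_append_right (by omega)]; simp [hlen]
  have h2 : C[l + 2]? = some (.test 0 0 0 0) := by
    rw [hC, List.getElem?_append_right (by omega)]; simp [hlen]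
  have h3 : C[l + 3]? = none := by simp [hC, hlen]
  have run : ∀ σ σ', Exec P σ σ' → Reach (fun q => C[q]?) (0, σ) (l, σ') := fun σ σ' h => by
    simpa using h.reach C [] _ hC
  refine ⟨C, fun n => ?_⟩
  have test : ∀ σ k, σ 0 = n → σ 1 = k → σ 3 = 0 → T n k ≠ 0 →
      ∃ σ', Reach (fun q => C[q]?) (0, σ) (l + 1, σ') ∧ σ' 0 = n ∧ σ' 1 = k ∧ σ' 3 = 0 := by
    intro σ k e0 e1 e3 hk
    obtain ⟨σ', he, f2, f0, f1, f3⟩ := hP' σ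
    refine ⟨σ', (run _ _ he).tail (.test_ne h0 ?_), f0.trans e0, f1.trans e1, f3.trans e3⟩
    rwa [f2, f3, e0, e1, e3]
  have count : ∀ k, (∀ k' < k, T n k' ≠ 0) → ∃ σ,
      Reach (fun q => C[q]?) (0, Pi.single 0 n) (0, σ) ∧ σ 0 = n ∧ σ 1 = k ∧ σ 3 = 0 := by
    intro k
    induction k with
    | zero => exact fun _ => ⟨_, .refl, by simp, by simp, by simp⟩
    | succ k ih =>
      intro hk
      obtain ⟨σ, hr, e0, e1, e3⟩ := ih fun k' hk' => hk k' (by omega)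
      obtain ⟨σ', hr', f0, f1, f3⟩ := test σ k e0 e1 e3 (hk k (by omega))
      exact ⟨_, ((hr.trans hr').tail (.succ h1)).tail (.test_eq h2 rfl), by simp [f0],
        by simp [f1], by simp [f3]⟩
  constructor
  · intro hn
    obtain ⟨σ, hr, e0, e1, e3⟩ := count (Nat.find hn) fun k hk => Nat.find_min hn hk
    obtain ⟨σ', he, f2, f0, f1, f3⟩ := hP' σ
    refine ⟨(l + 3, σ'), (hr.trans (run _ _ he)).tail (.test_eq h0 ?_), h3⟩
    rw [f2, f3, e0, e1, e3, Nat.find_spec hn]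
  · intro hn p
    obtain ⟨σ, hr, e0, e1, e3⟩ := count p fun k _ => hn k
    obtain ⟨σ', hr', f0, f1, f3⟩ := test σ p e0 e1 e3 (hn p)
    exact ⟨_, _, _, _, hr.trans hr', h1, f1.ge⟩

/-- A finite program mentions finitely many registers, and all addresses beyond its end behave
alike, so it can be renamed to finite types of states and registers. -/
theorem exists_search_machine {T : ℕ → ℕ → ℕ} (hT : Primrec₂ T) :
    ∃ (L N : ℕ) (M : Fin (L + 1) → Option (Instr (Fin (L + 1)) (Fin (N + 1)))), ∀ n,
      ((∃ k, T n k = 0) → Halts M (0, Pi.single 0 n)) ∧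
      ((∀ k, T n k ≠ 0) → Unbounded M (0, Pi.single 0 n)) := by
  obtain ⟨C, hC⟩ := exists_search_program hT
  set L := C.length with hL
  -- The sum bounds every register that occurs, so reduction modulo `N + 1` fixes all of them.
  set N := (C.flatMap Instr.regs).sum with hN
  -- Addresses are cut off at `L`, where there is no instruction, so halting is preserved.
  let f : ℕ → Fin (L + 1) := fun q => ⟨min q L, by omega⟩
  let g : ℕ → Fin (N + 1) := Fin.ofNat (N + 1)
  let h : Fin (N + 1) → ℕ := Fin.val
  have hget : ∀ q : ℕ, C[(f q).val]? = C[q]? := by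
    intro q
    rcases le_total q L with hq | hq
    · simp [f, hq]
    · rw [List.getElem?_eq_none hq, List.getElem?_eq_none (by simp only [f]; omega)]
  obtain ⟨M, hM⟩ : ∃ M : Fin (L + 1) → Option (Instr (Fin (L + 1)) (Fin (N + 1))),
      ∀ q, M (f q) = ((fun q => C[q]?) q).map (Instr.map f g) :=
    ⟨fun q => C[q.val]?.map (Instr.map f g), fun q => by simp only [hget]⟩
  refine ⟨L, N, M, fun n => ?_⟩
  have hgh : Function.LeftInverse g h := fun i => Fin.ofNat_val_eq_self i
  have hhg : ∀ (q : ℕ) (I : Instr ℕ ℕ), (fun q => C[q]?) q = some I →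
      ∀ i ∈ I.regs, h (g i) = i := by
    intro q I hI i hi
    have hm : i ∈ C.flatMap Instr.regs := List.mem_flatMap.2 ⟨I, List.mem_of_getElem? hI, hi⟩
    exact Nat.mod_eq_of_lt (Nat.lt_succ_of_le (List.le_sum_of_mem hm))
  have hinit : ((f 0, (Pi.single 0 n : ℕ → ℕ) ∘ h) : Fin (L + 1) × (Fin (N + 1) → ℕ)) =
      (0, Pi.single 0 n) := by
    refine Prod.ext (Fin.ext (by simp [f])) (funext fun i => ?_)
    rcases eq_or_ne i 0 with rfl | hi
    · simp [h]
    · simp [h, hi]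
  constructor
  · intro hn
    obtain ⟨c, hc, hc'⟩ := (hC n).1 hn
    have := hc.map hM hgh hhg
    rw [hinit] at this
    exact ⟨_, this, by rw [hM, hc']; rfl⟩
  · intro hn p
    obtain ⟨q, σ, i, q', hr, hq, hp⟩ := (hC n).2 hn p
    have := hr.map hM hgh hhg
    rw [hinit] at this
    refine ⟨_, _, g i, f q', this, by rw [hM, hq]; rfl, ?_⟩
    rwa [Function.comp_apply, hhg _ _ hq i (by simp [Instr.regs])]

end RegMachine

/-! ### The automaton that simulates a register machine. -/

namespace PERA

section Basic

variable {Act Loc Par : Type}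

/-- Deterministic description of the steps of an automaton without invariants. -/
theorem step_iff [DecidableEq Act] {A : PERA Act Loc Par} (hA : ∀ l, A.inv l = [])
    {v : ParamVal Par} {s s' : Loc × ClockVal Act} {d : ℝ≥0} {e : Edge Act Loc Par} :
    A.Step v s d e s' ↔ e ∈ A.edges ∧ s.1 = e.src ∧
      Guard.Sat v (fun x => s.2 x + d) e.guard ∧
      s' = (e.tgt, Function.update (fun x => s.2 x + d) e.act 0) := by
  have hst : ∀ s, A.IsState v s := fun s => by simp [IsState, hA, Guard.Sat]
  constructor
  · rintro ⟨m, ⟨rfl, -⟩, -, -, h1, h2, h3, h4, h5⟩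
    refine ⟨h1, h2, h5, Prod.ext h3 ?_⟩
    rw [h4]
    -- The semantics updates with the classical decidability instance, here with the given one.
    convert rfl
  · rintro ⟨h1, h2, h3, rfl⟩
    refine ⟨_, ⟨rfl, fun _ _ => hst _⟩, hst _, hst _, h1, h2, rfl, ?_, h3⟩
    convert rfl

theorem sat_cons {v : ParamVal Par} {w : ClockVal Act} {c : Atom Act Par} {g : Guard Act Par} :
    Guard.Sat v w (c :: g) ↔ c.rel.holds (w c.clock : ℝ) (boundVal v c.bound) ∧
      Guard.Sat v w g := List.forall_mem_cons

theorem sat_append {v : ParamVal Par} {w : ClockVal Act} {g g' : Guard Act Par} :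
    Guard.Sat v w (g ++ g') ↔ Guard.Sat v w g ∧ Guard.Sat v w g' := List.forall_mem_append

theorem sat_nil {v : ParamVal Par} {w : ClockVal Act} : Guard.Sat v w ([] : Guard Act Par) := by
  simp [Guard.Sat]

end Basic

open RegMachine

/-- Kinds of locations in the simulation of a register machine with states in `Q`. -/
inductive SimLoc (Q : Type) where
  | init
  | free
  | error
  | start (q : Q)
  | mid (q : Q)
  | done (q : Q)

namespace Sim

variable {N : ℕ} {Q Loc : Type}

/-- The action that ends a time window. -/
abbrev tick : Fin (N + 3) := 0

/-- The action that reports an error. -/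
abbrev err : Fin (N + 3) := 1

/-- The action of a register. -/
abbrev reg (i : Fin (N + 1)) : Fin (N + 3) := i.succ.succ

theorem reg_ne_tick (i : Fin (N + 1)) : reg i ≠ tick := Fin.succ_ne_zero _

theorem reg_ne_err (i : Fin (N + 1)) : reg i ≠ err := Fin.succ_succ_ne_one _

theorem reg_inj {i j : Fin (N + 1)} : reg i = reg j ↔ i = j := by simp [reg]

/-- The only parameter. -/
abbrev len : Fin 1 ⊕ ℤ := .inl 0

/-- The guard that a clock has a given value. -/
def eq (x : Fin (N + 3)) (η : Fin 1 ⊕ ℤ) : Guard (Fin (N + 3)) (Fin 1) :=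
  [⟨x, .le, η⟩, ⟨x, .ge, η⟩]

variable (ι : SimLoc Q → Loc)

/-- The edge from the initial location to the simulation with input `n`. -/
def entryEdge (q₀ : Q) (n : ℕ) : Edge (Fin (N + 3)) Loc (Fin 1) :=
  ⟨ι .init, ⟨tick, .lt, len⟩ :: eq tick (.inr n), reg 0, ι (.done q₀)⟩

/-- The edge to the error location that is enabled if the parameter is positive and at most the
input `n`. -/
def entryErrorEdge (n : ℕ) : Edge (Fin (N + 3)) Loc (Fin 1) :=
  ⟨ι .init, [⟨tick, .le, .inr n⟩, ⟨tick, .gt, .inr 0⟩] ++ eq tick len, err, ι .error⟩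

/-- The edges that accept all words without error, and the loop at the error location. -/
def freeEdges (a : Fin (N + 3)) : List (Edge (Fin (N + 3)) Loc (Fin 1)) :=
  if a = err then [⟨ι .error, [], a, ι .error⟩]
  else [⟨ι .init, [], a, ι .free⟩, ⟨ι .free, [], a, ι .free⟩]

/-- Every register clock is reset when it has reached the length of the window. -/
def resetEdges (q : Q) (k : Fin (N + 1)) : List (Edge (Fin (N + 3)) Loc (Fin 1)) :=
  [SimLoc.start q, .mid q, .done q].map fun l =>
    ⟨ι l, ⟨tick, .lt, len⟩ :: eq (reg k) len, reg k, ι l⟩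

/-- The end of a window. -/
def endEdge (q : Q) : Edge (Fin (N + 3)) Loc (Fin 1) :=
  ⟨ι (.done q), eq tick len ++ (List.finRange (N + 1)).map fun k => ⟨reg k, .le, len⟩, tick,
    ι (.start q)⟩

/-- The simulation of an instruction. -/
def instrEdges (q : Q) : Option (Instr Q (Fin (N + 1))) → List (Edge (Fin (N + 3)) Loc (Fin 1))
  | none => []
  | some (.zero j q') => [⟨ι (.start q), [⟨tick, .le, .inr 0⟩], reg j, ι (.done q')⟩]
  | some (.copy i j q') =>
    [⟨ι (.start q), ⟨tick, .lt, len⟩ :: eq (reg i) len, reg j, ι (.done q')⟩]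
  | some (.test i j q₁ q₂) =>
    [⟨ι (.start q), ⟨tick, .lt, len⟩ :: eq (reg i) len ++ eq (reg j) len, reg i, ι (.done q₁)⟩,
      ⟨ι (.start q), ⟨tick, .lt, len⟩ :: eq (reg i) len ++
        [⟨reg j, .gt, .inr 0⟩, ⟨reg j, .lt, len⟩], reg i, ι (.done q₂)⟩]
  | some (.succ i q') =>
    [⟨ι (.start q), ⟨tick, .lt, len⟩ :: eq (reg i) len, reg i, ι (.mid q)⟩,
      ⟨ι (.mid q), ⟨tick, .lt, len⟩ :: eq (reg i) (.inr 1), reg i, ι (.done q')⟩,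
      ⟨ι (.mid q), ⟨reg i, .le, .inr 1⟩ :: eq tick len, err, ι .error⟩]

/-- The edges that do not depend on the input. -/
def coreEdges (Qs : List Q) (M : Q → Option (Instr Q (Fin (N + 1)))) :
    List (Edge (Fin (N + 3)) Loc (Fin 1)) :=
  (List.finRange (N + 3)).flatMap (freeEdges ι) ++ Qs.flatMap fun q =>
    endEdge ι q :: (instrEdges ι q (M q) ++ (List.finRange (N + 1)).flatMap (resetEdges ι q))

/-- An automaton that, under a valuation with value `p > 0`, can read the action `err` exactly
if the machine `M` increments a number to a value at least `p`. -/
def aut (Qs : List Q) (M : Q → Option (Instr Q (Fin (N + 1)))) (q₀ : Q) (n : ℕ) :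
    PERA (Fin (N + 3)) Loc (Fin 1) where
  init := ι .init
  inv _ := []
  edges := entryEdge ι q₀ n :: entryErrorEdge ι n :: coreEdges ι Qs M

/-- The edges of the automaton as a predicate. -/
inductive IsEdge (M : Q → Option (Instr Q (Fin (N + 1)))) (q₀ : Q) (n : ℕ) :
    Edge (Fin (N + 3)) Loc (Fin 1) → Prop where
  | entry : IsEdge M q₀ n (entryEdge ι q₀ n)
  | entryError : IsEdge M q₀ n (entryErrorEdge ι n)
  | error : IsEdge M q₀ n ⟨ι .error, [], err, ι .error⟩
  | init {a} : a ≠ err → IsEdge M q₀ n ⟨ι .init, [], a, ι .free⟩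
  | free {a} : a ≠ err → IsEdge M q₀ n ⟨ι .free, [], a, ι .free⟩
  | reset {l q k} : l ∈ [SimLoc.start q, .mid q, .done q] →
      IsEdge M q₀ n ⟨ι l, ⟨tick, .lt, len⟩ :: eq (reg k) len, reg k, ι l⟩
  | window {q} : IsEdge M q₀ n (endEdge ι q)
  | instr {q e} : e ∈ instrEdges ι q (M q) → IsEdge M q₀ n e

variable {ι}

theorem mem_edges {Qs : List Q} (hQs : ∀ q, q ∈ Qs) {M : Q → Option (Instr Q (Fin (N + 1)))}
    {q₀ : Q} {n : ℕ} {e : Edge (Fin (N + 3)) Loc (Fin 1)} :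
    e ∈ (aut ι Qs M q₀ n).edges ↔ IsEdge ι M q₀ n e := by
  simp only [aut, coreEdges, List.mem_cons, List.mem_append, List.mem_flatMap, List.mem_finRange,
    true_and, hQs]
  constructor
  · rintro (rfl | rfl | ⟨a, h⟩ | ⟨q, rfl | h | ⟨k, h⟩⟩)
    · exact .entry
    · exact .entryError
    · unfold freeEdges at h
      split_ifs at h with ha
      · rw [List.mem_singleton.1 h, ha]
        exact .error
      · rcases List.mem_pair.1 h with rfl | rfl
        exacts [.init ha, .free ha]
    · exact .window
    · exact .instr h
    · obtain ⟨l, hl, rfl⟩ := List.mem_map.1 h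
      exact .reset hl
  · rintro (_ | _ | _ | ha | ha | hl | _ | h)
    · exact .inl rfl
    · exact .inr (.inl rfl)
    · exact .inr (.inr (.inl ⟨err, by simp [freeEdges]⟩))
    · exact .inr (.inr (.inl ⟨_, by rw [freeEdges, if_neg ha]; simp⟩))
    · exact .inr (.inr (.inl ⟨_, by rw [freeEdges, if_neg ha]; simp⟩))
    · exact .inr (.inr (.inr ⟨_, .inr (.inr ⟨_, List.mem_map.2 ⟨_, hl, rfl⟩⟩)⟩))
    · exact .inr (.inr (.inr ⟨_, .inl rfl⟩))
    · exact .inr (.inr (.inr ⟨_, .inr (.inl h)⟩))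

/-! ### Numbers as reset times within a window. -/

/-- The register clocks encode the numbers `σ` in a window of length `p`: the clock of `k` is reset
at time `σ k`. -/
def Enc (p : ℝ) (σ : Fin (N + 1) → ℕ) (w : ClockVal (Fin (N + 3))) : Prop :=
  ∀ k, (w (reg k) : ℝ) = w tick + p - σ k ∨ (w (reg k) : ℝ) = w tick - σ k

theorem Enc.delay {p : ℝ} {σ : Fin (N + 1) → ℕ} {w : ClockVal (Fin (N + 3))} (h : Enc p σ w)
    (d : ℝ≥0) : Enc p σ fun x => w x + d := by
  intro k
  push_cast
  exact (h k).imp (fun h => by rw [h]; ring) fun h => by rw [h]; ring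

/-- A reset at time `m` of the window writes `m`, whether or not the clock was already reset in this
window. -/
theorem Enc.update {p : ℝ} {σ : Fin (N + 1) → ℕ} {w : ClockVal (Fin (N + 3))} (h : Enc p σ w)
    (i : Fin (N + 1)) (m : ℕ) (hm : (w tick : ℝ) = m) :
    Enc p (Function.update σ i m) (Function.update w (reg i) 0) := by
  intro k
  have ht : Function.update w (reg i) 0 tick = w tick :=
    Function.update_of_ne (reg_ne_tick i).symm _ _
  rw [ht]
  rcases eq_or_ne k i with rfl | hk
  · right
    simp [hm]
  · rw [Function.update_of_ne hk, Function.update_of_ne (mt reg_inj.1 hk)]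
    exact h k

/-- The register clock that has the value `p` before the end of a window is reset at the correct
time. -/
theorem Enc.tick_eq {p : ℝ} {σ : Fin (N + 1) → ℕ} {w : ClockVal (Fin (N + 3))} (h : Enc p σ w)
    {k : Fin (N + 1)} (hk : (w (reg k) : ℝ) = p) (ht : (w tick : ℝ) < p) :
    (w tick : ℝ) = σ k := by
  have := (Nat.cast_nonneg (σ k) : (0 : ℝ) ≤ σ k)
  rcases h k with h | h <;> linarith

theorem Enc.reset {p : ℝ} {σ : Fin (N + 1) → ℕ} {w : ClockVal (Fin (N + 3))} (h : Enc p σ w)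
    {k : Fin (N + 1)} (hk : (w (reg k) : ℝ) = p) (ht : (w tick : ℝ) < p) :
    Enc p σ (Function.update w (reg k) 0) := by
  simpa using h.update k (σ k) (h.tick_eq hk ht)

/-- A clock whose reset was missed would show `2 * p - σ k > p`, which the guard at the end of the
window excludes. The other clocks show `p - σ k`, the pending value at time `0` of the next window.
-/
theorem Enc.window {p : ℝ} {σ : Fin (N + 1) → ℕ} {w : ClockVal (Fin (N + 3))} (h : Enc p σ w)
    (hσ : ∀ k, (σ k : ℝ) < p) (ht : (w tick : ℝ) = p) (hw : ∀ k, (w (reg k) : ℝ) ≤ p) :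
    Enc p σ (Function.update w tick 0) := by
  intro k
  have := hσ k
  have := hw k
  rw [Function.update_self, Function.update_of_ne (reg_ne_tick k)]
  left
  rcases h k with h | h
  · linarith
  · rw [h, ht, NNReal.coe_zero]; ring

/-- The invariant of the runs, when the machine is started in the configuration `c`. -/
def Inv (M : Q → Option (Instr Q (Fin (N + 1)))) (c : Q × (Fin (N + 1) → ℕ)) (p : ℝ)
    (w : ClockVal (Fin (N + 3))) : SimLoc Q → Prop
  | .init => ∀ x, w x = 0
  | .free => True
  | .error => False
  | .start q => ∃ σ, Reach M c (q, σ) ∧ (∀ k, (σ k : ℝ) < p) ∧ Enc p σ w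
  | .mid q => ∃ σ, Reach M c (q, σ) ∧ (∀ k, (σ k : ℝ) < p) ∧ Enc p σ w ∧
      ∃ i q', M q = some (.succ i q') ∧ (w (reg i) : ℝ) = w tick - σ i
  | .done q => ∃ σ, Reach M c (q, σ) ∧ (∀ k, (σ k : ℝ) < p) ∧ Enc p σ w

/-- The value of the parameter. -/
abbrev value (v : ParamVal (Fin 1)) : ℝ := ((v 0 : ℚ) : ℝ)

theorem sat_eq {v : ParamVal (Fin 1)} {w : ClockVal (Fin (N + 3))} {x : Fin (N + 3)}
    {η : Fin 1 ⊕ ℤ} : Guard.Sat v w (eq x η) ↔ (w x : ℝ) = boundVal v η := by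
  simp only [eq, sat_cons, Rel.holds, sat_nil, and_true]
  exact ⟨fun h => le_antisymm h.1 h.2, fun h => ⟨h.le, h.ge⟩⟩

theorem sat_end {v : ParamVal (Fin 1)} {w : ClockVal (Fin (N + 3))} {q : Q} :
    Guard.Sat v w (endEdge ι q).guard ↔
      (w tick : ℝ) = value v ∧ ∀ k : Fin (N + 1), (w (reg k) : ℝ) ≤ value v := by
  rw [endEdge, sat_append, sat_eq]
  simp [Guard.Sat, Rel.holds, boundVal]

/-! ### Soundness: runs of the automaton follow the machine. -/

section Soundness

variable {M : Q → Option (Instr Q (Fin (N + 1)))} {q₀ : Q} {n : ℕ} {v : ParamVal (Fin 1)}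

/-- One step preserves the invariant, if the numbers of the machine are below the parameter. -/
theorem Inv.step (hι : Function.Injective ι) (hn : (n : ℝ) < value v ∨ value v = 0)
    (hM : ∀ q σ i q', Reach M (q₀, Pi.single 0 n) (q, σ) → M q = some (.succ i q') →
      (σ i + 1 : ℝ) < value v ∨ value v = 0)
    {e : Edge (Fin (N + 3)) Loc (Fin 1)} (he : IsEdge ι M q₀ n e) {l : SimLoc Q}
    (hl : e.src = ι l) {w : ClockVal (Fin (N + 3))} (hw : Inv M (q₀, Pi.single 0 n) (value v) w l)
    {d : ℝ≥0} (hg : Guard.Sat v (fun x => w x + d) e.guard) :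
    ∃ l', e.tgt = ι l' ∧ Inv M (q₀, Pi.single 0 n) (value v)
      (Function.update (fun x => w x + d) e.act 0) l' := by
  have upd : ∀ (k : Fin (N + 1)),
      Function.update (fun x => w x + d) (reg k) 0 tick = w tick + d := fun k =>
    Function.update_of_ne (reg_ne_tick k).symm _ _
  cases he with
  | entry =>
    obtain rfl := hι hl
    simp only [entryEdge, sat_cons, sat_eq, Rel.holds, boundVal] at hg
    simp only [Int.cast_natCast] at hg
    obtain ⟨h1, h2⟩ := hg
    refine ⟨.done q₀, rfl, _, .refl, fun k => ?_, ?_⟩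
    · rw [h2] at h1
      rcases eq_or_ne k 0 with rfl | hk
      · simpa using h1
      · simpa [hk] using (Nat.cast_nonneg n).trans_lt h1
    -- Up to time `n` all clocks agree with `tick`, so every register counts as reset at time `0`.
    · refine Enc.update (σ := 0) (fun k => .inr ?_) 0 n h2
      simp [hw tick, hw (reg k)]
  | entryError =>
    obtain rfl := hι hl
    simp only [entryErrorEdge, sat_append, sat_cons, sat_eq, Rel.holds, boundVal] at hg
    simp only [Int.cast_natCast, Int.cast_zero] at hg
    obtain ⟨⟨h1, h2, -⟩, h3⟩ := hg
    rw [h3] at h1 h2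
    rcases hn with hn | hn
    · exact absurd hn h1.not_gt
    · exact absurd hn h2.ne'
  | error =>
    obtain rfl := hι hl
    exact hw.elim
  | init => exact ⟨.free, rfl, trivial⟩
  | free => exact ⟨.free, rfl, trivial⟩
  | @reset l' q k hl' =>
    obtain rfl := hι hl
    refine ⟨l', rfl, ?_⟩
    simp only [sat_cons, sat_eq, Rel.holds, boundVal] at hg
    obtain ⟨h1, h2⟩ := hg
    simp only [List.mem_cons, List.not_mem_nil, or_false] at hl'
    rcases hl' with rfl | rfl | rfl
    · obtain ⟨σ, h3, h4, h5⟩ := hw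
      exact ⟨σ, h3, h4, (h5.delay d).reset h2 h1⟩
    · obtain ⟨σ, h3, h4, h5, i, q', h6, h7⟩ := hw
      refine ⟨σ, h3, h4, (h5.delay d).reset h2 h1, i, q', h6, ?_⟩
      have := (Nat.cast_nonneg (σ i) : (0 : ℝ) ≤ σ i)
      rw [upd]
      rcases eq_or_ne i k with rfl | hik
      -- The clock of `i` was already reset in this window and is below `p`, so it cannot be reset
      -- by this edge.
      · push_cast at h1 h2
        linarith
      · rw [Function.update_of_ne (mt reg_inj.1 hik)]
        push_cast
        linarith
    · obtain ⟨σ, h3, h4, h5⟩ := hw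
      exact ⟨σ, h3, h4, (h5.delay d).reset h2 h1⟩
  | @window q =>
    obtain rfl := hι hl
    obtain ⟨σ, h3, h4, h5⟩ := hw
    obtain ⟨h1, h2⟩ := sat_end.1 hg
    exact ⟨.start q, rfl, σ, h3, h4, (h5.delay d).window h4 h1 h2⟩
  | @instr q _ he =>
    -- Inside the simulation the parameter is positive, so the alternative `value v = 0` is void
    -- there.
    have pos : ∀ σ : Fin (N + 1) → ℕ, (∀ k, (σ k : ℝ) < value v) → 0 < value v := fun σ h =>
      (Nat.cast_nonneg _).trans_lt (h 0)
    match hq : M q with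
    | none => simp [hq, instrEdges] at he
    | some (.zero j q') =>
      simp only [hq, instrEdges, List.mem_singleton] at he
      subst he
      obtain rfl := hι hl
      obtain ⟨σ, h3, h4, h5⟩ := hw
      simp only [sat_cons, Rel.holds, boundVal, Int.cast_zero] at hg
      have ht := le_antisymm hg.1 (NNReal.coe_nonneg _)
      refine ⟨_, rfl, _, h3.tail (.zero hq), fun k => ?_,
        (h5.delay d).update j 0 (by simpa using ht)⟩
      rcases eq_or_ne k j with rfl | hk
      · simpa using pos σ h4
      · simpa [hk] using h4 k
    | some (.copy i j q') =>
      simp only [hq, instrEdges, List.mem_singleton] at he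
      subst he
      obtain rfl := hι hl
      obtain ⟨σ, h3, h4, h5⟩ := hw
      simp only [sat_cons, sat_eq, Rel.holds, boundVal] at hg
      refine ⟨_, rfl, _, h3.tail (.copy hq), fun k => ?_,
        (h5.delay d).update j _ ((h5.delay d).tick_eq hg.2 hg.1)⟩
      rcases eq_or_ne k j with rfl | hk
      · simpa using h4 i
      · simpa [hk] using h4 k
    | some (.test i j q₁ q₂) =>
      simp only [hq, instrEdges, List.mem_pair] at he
      rcases he with rfl | rfl
      · obtain rfl := hι hl
        obtain ⟨σ, h3, h4, h5⟩ := hw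
        simp only [sat_append, sat_cons, sat_eq, Rel.holds, boundVal] at hg
        obtain ⟨⟨h1, h2⟩, h6⟩ := hg
        have e := ((h5.delay d).tick_eq h2 h1).symm.trans ((h5.delay d).tick_eq h6 h1)
        exact ⟨_, rfl, σ, h3.tail (.test_eq hq (by exact_mod_cast e)), h4,
          (h5.delay d).reset h2 h1⟩
      · obtain rfl := hι hl
        obtain ⟨σ, h3, h4, h5⟩ := hw
        simp only [sat_append, sat_cons, sat_eq, Rel.holds, boundVal, Int.cast_zero] at hg
        obtain ⟨⟨h1, h2⟩, h6, h7, -⟩ := hg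
        refine ⟨_, rfl, σ, h3.tail (.test_ne hq fun e => ?_), h4, (h5.delay d).reset h2 h1⟩
        have e' : (σ i : ℝ) = σ j := by exact_mod_cast e
        have ht := (h5.delay d).tick_eq h2 h1
        -- If the registers were equal, the clock of `j` would now be `p` or `0`, both excluded by
        -- the guard.
        rcases (h5.delay d) j with h | h <;> linarith
    | some (.succ i q') =>
      simp only [hq, instrEdges, List.mem_cons, List.not_mem_nil, or_false] at he
      rcases he with rfl | rfl | rfl
      · obtain rfl := hι hl
        obtain ⟨σ, h3, h4, h5⟩ := hw
        simp only [sat_cons, sat_eq, Rel.holds, boundVal] at hg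
        refine ⟨_, rfl, σ, h3, h4, (h5.delay d).reset hg.2 hg.1, i, q', hq, ?_⟩
        have ht := (h5.delay d).tick_eq hg.2 hg.1
        rw [upd, Function.update_self, ht]
        simp
      · obtain rfl := hι hl
        obtain ⟨σ, h3, h4, h5, i', q'', h6, h7⟩ := hw
        obtain ⟨rfl, rfl⟩ : i = i' ∧ q' = q'' := by simpa [hq] using h6
        simp only [sat_cons, sat_eq, Rel.holds, boundVal, Int.cast_one] at hg
        obtain ⟨h1, h2⟩ := hg
        have ht : ((w tick + d : ℝ≥0) : ℝ) = (σ i + 1 : ℕ) := by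
          push_cast at h2 ⊢
          linarith
        refine ⟨_, rfl, _, h3.tail (.succ hq), fun k => ?_, (h5.delay d).update i _ ht⟩
        rcases eq_or_ne k i with rfl | hk
        · rw [Function.update_self, ← ht]
          exact h1
        · simpa [hk] using h4 k
      · obtain rfl := hι hl
        obtain ⟨σ, h3, h4, h5, i', q'', h6, h7⟩ := hw
        obtain ⟨rfl, rfl⟩ : i = i' ∧ q' = q'' := by simpa [hq] using h6
        simp only [sat_cons, sat_eq, Rel.holds, boundVal, Int.cast_one] at hg
        obtain ⟨h1, h2⟩ := hg
        push_cast at h1 h2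
        change _ = value v at h2
        -- At time `p` the clock of `i` shows `p - σ i`, so the guard says `p ≤ σ i + 1`.
        rcases hM q σ i q' h3 hq with h | h
        · linarith
        · exact absurd h (pos σ h4).ne'

theorem Inv.finRun (hι : Function.Injective ι) {Qs : List Q} (hQs : ∀ q, q ∈ Qs)
    (hn : (n : ℝ) < value v ∨ value v = 0)
    (hM : ∀ q σ i q', Reach M (q₀, Pi.single 0 n) (q, σ) → M q = some (.succ i q') →
      (σ i + 1 : ℝ) < value v ∨ value v = 0)
    {u : List (Fin (N + 3))} {s : Loc × ClockVal (Fin (N + 3))}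
    (hs : (aut ι Qs M q₀ n).FinRun v u s) :
    ∃ l, s.1 = ι l ∧ Inv M (q₀, Pi.single 0 n) (value v) s.2 l := by
  induction hs with
  | start => exact ⟨.init, rfl, fun _ => rfl⟩
  | snoc _ h ih =>
    obtain ⟨h1, h2, h3, rfl⟩ := (step_iff fun _ => rfl).1 h
    obtain ⟨l, hl, hw⟩ := ih
    exact hw.step hι hn hM ((mem_edges hQs).1 h1) (h2.symm.trans hl) h3

end Soundness

/-! ### Completeness: every computation is simulated until an error is reachable. -/

section Completeness

variable {M : Q → Option (Instr Q (Fin (N + 1)))} {q₀ : Q} {n : ℕ} {v : ParamVal (Fin 1)}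

/-- The configurations that a run can reach, possibly with a final delay. -/
def CanReach (A : PERA (Fin (N + 3)) Loc (Fin 1)) (v : ParamVal (Fin 1)) (l : Loc)
    (w : ClockVal (Fin (N + 3))) : Prop :=
  ∃ u w' d, A.FinRun v u (l, w') ∧ w = fun x => w' x + d

theorem CanReach.delay {A : PERA (Fin (N + 3)) Loc (Fin 1)} {l : Loc}
    {w : ClockVal (Fin (N + 3))} (h : CanReach A v l w) {t : ℝ} (ht : (w tick : ℝ) ≤ t) :
    ∃ w' : ClockVal (Fin (N + 3)), CanReach A v l w' ∧ (w' tick : ℝ) = t ∧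
      ∀ x, (w' x : ℝ) = w x + (t - w tick) := by
  obtain ⟨u, w₀, d, hr, rfl⟩ := h
  obtain ⟨d', hd'⟩ : ∃ d' : ℝ≥0, (d' : ℝ) = t - (w₀ tick + d : ℝ≥0) :=
    ⟨⟨_, sub_nonneg.2 ht⟩, rfl⟩
  refine ⟨fun x => w₀ x + (d + d'), ⟨u, w₀, d + d', hr, rfl⟩, ?_, fun x => ?_⟩ <;>
  · push_cast at hd' ⊢
    linarith

theorem CanReach.edge {Qs : List Q} (hQs : ∀ q, q ∈ Qs) {l : SimLoc Q}
    {w : ClockVal (Fin (N + 3))} (h : CanReach (aut ι Qs M q₀ n) v (ι l) w)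
    {e : Edge (Fin (N + 3)) Loc (Fin 1)} (he : IsEdge ι M q₀ n e) (hl : e.src = ι l)
    (hg : Guard.Sat v w e.guard) :
    CanReach (aut ι Qs M q₀ n) v e.tgt (Function.update w e.act 0) := by
  obtain ⟨u, w₀, d, hr, rfl⟩ := h
  refine ⟨_, _, 0, hr.snoc ((step_iff (d := d) fun _ => rfl).2
    ⟨(mem_edges hQs).2 he, hl.symm, hg, rfl⟩), ?_⟩
  simp

/-- The register clocks are reset in the right order until the time `T`. -/
theorem CanReach.flush {Qs : List Q} (hQs : ∀ q, q ∈ Qs) {l : SimLoc Q} {q : Q}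
    (hl : l ∈ [SimLoc.start q, .mid q, .done q])
    {σ : Fin (N + 1) → ℕ} {T : ℝ} (hT : T ≤ value v) {w : ClockVal (Fin (N + 3))}
    (h : CanReach (aut ι Qs M q₀ n) v (ι l) w) (ht : (w tick : ℝ) ≤ T)
    (hw : ∀ k, (w (reg k) : ℝ) = w tick + value v - σ k ∧ (w tick : ℝ) ≤ σ k ∨
      (w (reg k) : ℝ) = w tick - σ k) :
    ∃ w', CanReach (aut ι Qs M q₀ n) v (ι l) w' ∧ (w' tick : ℝ) = T ∧
      ∀ k, ((σ k : ℝ) < T → (w' (reg k) : ℝ) = T - σ k) ∧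
        (T ≤ σ k → (w' (reg k) : ℝ) = w (reg k) + (T - w tick)) := by
  classical
  -- The set of registers that are due before `T` and still pending; each reset removes one.
  let S : ClockVal (Fin (N + 3)) → Finset (Fin (N + 1)) := fun w =>
    Finset.univ.filter fun k => (σ k : ℝ) < T ∧ (w (reg k) : ℝ) ≠ w tick - σ k
  induction hc : (S w).card using Nat.strong_induction_on generalizing w with
  | _ c ih =>
    subst hc
    rcases (S w).eq_empty_or_nonempty with hS | hS
    · obtain ⟨w', h1, h2, h3⟩ := h.delay ht
      refine ⟨w', h1, h2, fun k => ⟨fun hk => ?_, fun hk => h3 _⟩⟩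
      have : (w (reg k) : ℝ) = w tick - σ k := by
        by_contra hne
        have : k ∈ S w := by simp [S, hk, hne]
        simp [hS] at this
      rw [h3, this]; ring
    -- The pending register with the least number is due next.
    · obtain ⟨i, hi, hmin⟩ := (S w).exists_min_image σ hS
      obtain ⟨-, hiT, hiw⟩ := Finset.mem_filter.1 hi
      obtain ⟨hi1, hi2⟩ := (hw i).resolve_right hiw
      obtain ⟨w₁, h1, h2, h3⟩ := h.delay hi2
      have h4 := h1.edge hQs (.reset (k := i) hl) rfl (by
        simp only [sat_cons, sat_eq, Rel.holds, boundVal]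
        refine ⟨by rw [h2]; exact hiT.trans_le hT, ?_⟩
        rw [h3, hi1]; simp only [value]; ring)
      set w₂ := Function.update w₁ (reg i) 0 with hw₂
      have t2 : (w₂ tick : ℝ) = σ i := by
        rw [hw₂, Function.update_of_ne (reg_ne_tick i).symm, h2]
      have r2 : (w₂ (reg i) : ℝ) = 0 := by simp [hw₂]
      have r3 : ∀ k, k ≠ i → (w₂ (reg k) : ℝ) = w (reg k) + (σ i - w tick) := fun k hk => by
        rw [hw₂, Function.update_of_ne (mt reg_inj.1 hk), h3]
      have hsub : S w₂ ⊆ (S w).erase i := by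
        intro k hk
        obtain ⟨-, hk1, hk2⟩ := Finset.mem_filter.1 hk
        have hki : k ≠ i := by
          rintro rfl
          exact hk2 (by rw [r2, t2]; ring)
        refine Finset.mem_erase.2 ⟨hki, Finset.mem_filter.2 ⟨Finset.mem_univ _, hk1, fun e => ?_⟩⟩
        exact hk2 (by rw [r3 k hki, t2, e]; ring)
      obtain ⟨w', g1, g2, g3⟩ := ih _ (((Finset.card_le_card hsub).trans_lt
        (Finset.card_erase_lt_of_mem hi))) h4 (by rw [t2]; exact hiT.le) (fun k => by
          rcases eq_or_ne k i with rfl | hk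
          · right; rw [r2, t2]; ring
          · rw [r3 k hk, t2]
            by_cases hkd : (w (reg k) : ℝ) = w tick - σ k
            · right; rw [hkd]; ring
            · obtain ⟨hk1, hk2⟩ := (hw k).resolve_right hkd
              refine .inl ⟨by rw [hk1]; ring, ?_⟩
              -- No pending register is overdue at time `σ i`: by minimality of `σ i`, or because `σ
              -- i < T ≤ σ k`.
              by_cases hkT : (σ k : ℝ) < T
              · exact_mod_cast hmin k (by simp [S, hkT, hkd])
              · linarith) rfl
      refine ⟨w', g1, g2, fun k => ⟨(g3 k).1, fun hk => ?_⟩⟩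
      rw [(g3 k).2 hk, r3 k (by rintro rfl; linarith), t2]; ring

/-- The automaton can reach the beginning of a window in which the numbers `σ` are encoded. -/
def CanStart (A : PERA (Fin (N + 3)) Loc (Fin 1)) (ι : SimLoc Q → Loc) (v : ParamVal (Fin 1))
    (q : Q) (σ : Fin (N + 1) → ℕ) : Prop :=
  (∀ k, (σ k : ℝ) < value v) ∧ ∃ w, CanReach A v (ι (.start q)) w ∧ (w tick : ℝ) = 0 ∧
    ∀ k, (w (reg k) : ℝ) = value v - σ k

/-- Since every number is below `p`, all pending clocks can be reset before time `p`, when the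
window may close. -/
theorem CanReach.finish {Qs : List Q} (hQs : ∀ q, q ∈ Qs) {q : Q} {σ : Fin (N + 1) → ℕ}
    (hσ : ∀ k, (σ k : ℝ) < value v) {w : ClockVal (Fin (N + 3))}
    (h : CanReach (aut ι Qs M q₀ n) v (ι (.done q)) w) (ht : (w tick : ℝ) ≤ value v)
    (hw : ∀ k, (w (reg k) : ℝ) = w tick + value v - σ k ∧ (w tick : ℝ) ≤ σ k ∨
      (w (reg k) : ℝ) = w tick - σ k) :
    CanStart (aut ι Qs M q₀ n) ι v q σ := by
  obtain ⟨w₁, h1, h2, h3⟩ := h.flush hQs (q := q) (by simp) le_rfl ht hw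
  have h4 := fun k => (h3 k).1 (hσ k)
  refine ⟨hσ, _, h1.edge hQs .window rfl (sat_end.2 ⟨h2, fun k => ?_⟩), ?_, fun k => ?_⟩
  · rw [h4 k]
    linarith [(Nat.cast_nonneg (σ k) : (0 : ℝ) ≤ σ k)]
  · simp [endEdge]
  · simp only [endEdge]
    rw [Function.update_of_ne (reg_ne_tick k), h4]

/-- At the time at which the clock of the register `i` reaches the length of the window. -/
theorem CanStart.reach {Qs : List Q} (hQs : ∀ q, q ∈ Qs) {q : Q} {σ : Fin (N + 1) → ℕ}
    (h : CanStart (aut ι Qs M q₀ n) ι v q σ) (i : Fin (N + 1)) :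
    ∃ w, CanReach (aut ι Qs M q₀ n) v (ι (.start q)) w ∧ (w tick : ℝ) = σ i ∧
      ∀ k, (σ k < σ i → (w (reg k) : ℝ) = w tick - σ k) ∧
        (σ i ≤ σ k → (w (reg k) : ℝ) = w tick + value v - σ k) := by
  obtain ⟨hσ, w, h1, h2, h3⟩ := h
  obtain ⟨w', h4, h5, h6⟩ := h1.flush hQs (σ := σ) (q := q) (by simp) (hσ i).le (by simp [h2])
    (fun k => .inl ⟨by rw [h3, h2]; ring, by simp [h2]⟩)
  refine ⟨w', h4, h5, fun k => ⟨fun hk => ?_, fun hk => ?_⟩⟩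
  · rw [(h6 k).1 (by exact_mod_cast hk), h5]
  · rw [(h6 k).2 (by exact_mod_cast hk), h5, h2, h3]; ring

/-- A clock that is reset at time `m` encodes the number `m`. -/
theorem sched_update {p : ℝ} {σ : Fin (N + 1) → ℕ} {w : ClockVal (Fin (N + 3))}
    (hw : ∀ k, (w (reg k) : ℝ) = w tick + p - σ k ∧ (w tick : ℝ) ≤ σ k ∨
      (w (reg k) : ℝ) = w tick - σ k) (i : Fin (N + 1)) (m : ℕ) (hm : (w tick : ℝ) = m)
    (k : Fin (N + 1)) :
    (Function.update w (reg i) 0 (reg k) : ℝ) =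
      Function.update w (reg i) 0 tick + p - Function.update σ i m k ∧
        (Function.update w (reg i) 0 tick : ℝ) ≤ Function.update σ i m k ∨
    (Function.update w (reg i) 0 (reg k) : ℝ) =
      Function.update w (reg i) 0 tick - Function.update σ i m k := by
  rw [Function.update_of_ne (reg_ne_tick i).symm]
  rcases eq_or_ne k i with rfl | hk
  · right
    simp [hm]
  · rw [Function.update_of_ne hk, Function.update_of_ne (mt reg_inj.1 hk)]
    exact hw k

/-- First half of an increment: once the clock of `i` is reset at time `σ i`, its value `1` marks
the time `σ i + 1`. -/
theorem CanStart.mid {Qs : List Q} (hQs : ∀ q, q ∈ Qs) {q q' : Q} {i : Fin (N + 1)}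
    {σ : Fin (N + 1) → ℕ} (h : CanStart (aut ι Qs M q₀ n) ι v q σ)
    (hq : M q = some (.succ i q')) :
    ∃ w, CanReach (aut ι Qs M q₀ n) v (ι (.mid q)) w ∧ (w tick : ℝ) = σ i ∧ w (reg i) = 0 ∧
      ∀ k, (w (reg k) : ℝ) = w tick + value v - σ k ∧ (w tick : ℝ) ≤ σ k ∨
        (w (reg k) : ℝ) = w tick - σ k := by
  obtain ⟨w, h1, h2, h3⟩ := h.reach hQs i
  have hw : ∀ k, (w (reg k) : ℝ) = w tick + value v - σ k ∧ (w tick : ℝ) ≤ σ k ∨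
      (w (reg k) : ℝ) = w tick - σ k := fun k => by
    rcases lt_or_ge (σ k) (σ i) with hk | hk
    · exact .inr ((h3 k).1 hk)
    · exact .inl ⟨(h3 k).2 hk, by rw [h2]; exact_mod_cast hk⟩
  have hi : (w (reg i) : ℝ) = value v := by rw [(h3 i).2 le_rfl, h2]; ring
  have := h1.edge hQs (.instr (q := q) (by rw [hq]; exact List.mem_cons_self)) rfl (by
    simp only [sat_cons, sat_eq, Rel.holds, boundVal]
    exact ⟨by rw [h2]; exact h.1 i, hi⟩)
  refine ⟨_, this, ?_, Function.update_self .., ?_⟩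
  · rw [Function.update_of_ne (reg_ne_tick i).symm, h2]
  · simpa using sched_update hw i (σ i) h2

/-- The error is reachable when a number gets too large. -/
theorem CanStart.error {Qs : List Q} (hQs : ∀ q, q ∈ Qs) {q q' : Q} {i : Fin (N + 1)}
    {σ : Fin (N + 1) → ℕ} (h : CanStart (aut ι Qs M q₀ n) ι v q σ)
    (hq : M q = some (.succ i q')) (hσ : value v ≤ σ i + 1) :
    ∃ w, CanReach (aut ι Qs M q₀ n) v (ι .error) w := by
  obtain ⟨w, h1, h2, h3, -⟩ := h.mid hQs hq
  obtain ⟨w₁, h4, h5, h6⟩ := h1.delay (t := value v) (by rw [h2]; exact (h.1 i).le)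
  refine ⟨_, h4.edge hQs (.instr (q := q) (by
    rw [hq]; exact List.mem_cons_of_mem _ (List.mem_cons_of_mem _ List.mem_cons_self))) rfl ?_⟩
  simp only [sat_cons, sat_eq, Rel.holds, boundVal, Int.cast_one]
  refine ⟨?_, h5⟩
  rw [h6, h3, h2, NNReal.coe_zero]
  linarith

/-- The automaton simulates a step of the machine, unless it can reach the error. -/
theorem CanStart.step {Qs : List Q} (hQs : ∀ q, q ∈ Qs) {c c' : Q × (Fin (N + 1) → ℕ)}
    (h : CanStart (aut ι Qs M q₀ n) ι v c.1 c.2) (hs : RegMachine.Step M c c') :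
    (∃ w, CanReach (aut ι Qs M q₀ n) v (ι .error) w) ∨
      CanStart (aut ι Qs M q₀ n) ι v c'.1 c'.2 := by
  have hlt : ∀ {σ : Fin (N + 1) → ℕ} (i : Fin (N + 1)) (m : ℕ), (∀ k, (σ k : ℝ) < value v) →
      (m : ℝ) < value v → ∀ k, ((Function.update σ i m k : ℕ) : ℝ) < value v := by
    intro σ i m hσ hm k
    rcases eq_or_ne k i with rfl | hk
    · simpa using hm
    · simpa [hk] using hσ k
  have sched : ∀ {σ : Fin (N + 1) → ℕ} {i : Fin (N + 1)} {w : ClockVal (Fin (N + 3))},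
      (w tick : ℝ) = σ i → (∀ k, (σ k < σ i → (w (reg k) : ℝ) = w tick - σ k) ∧
        (σ i ≤ σ k → (w (reg k) : ℝ) = w tick + value v - σ k)) →
      ∀ k, (w (reg k) : ℝ) = w tick + value v - σ k ∧ (w tick : ℝ) ≤ σ k ∨
        (w (reg k) : ℝ) = w tick - σ k := by
    intro σ i w h2 h3 k
    rcases lt_or_ge (σ k) (σ i) with hk | hk
    · exact .inr ((h3 k).1 hk)
    · exact .inl ⟨(h3 k).2 hk, by rw [h2]; exact_mod_cast hk⟩
  cases hs with
  | @zero q q' j σ hq =>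
    right
    obtain ⟨hσ, w, h1, h2, h3⟩ := h
    have hp : (0 : ℝ) < value v := (Nat.cast_nonneg _).trans_lt (hσ 0)
    refine CanReach.finish hQs (hlt _ _ hσ (by simpa using hp))
      (h1.edge hQs (.instr (q := q) (by rw [hq]; exact List.mem_cons_self)) rfl (by
        simp [sat_cons, Rel.holds, boundVal, sat_nil, h2])) ?_
      (sched_update (fun k => .inl ⟨by rw [h3, h2]; ring, by simp [h2]⟩) _ _ (by simpa using h2))
    rw [Function.update_of_ne (reg_ne_tick j).symm, h2]
    exact hp.le
  | @succ q q' i σ hq =>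
    rcases le_or_gt (value v) (σ i + 1) with hv | hv
    · exact .inl (h.error hQs hq hv)
    · right
      obtain ⟨w, h1, h2, h3, h4⟩ := h.mid hQs hq
      obtain ⟨w', h5, h6, h7⟩ := h1.flush hQs (q := q) (by simp) hv.le (by rw [h2]; simp) h4
      have hi : (w' (reg i) : ℝ) = 1 := by
        rw [(h7 i).1 (by simp)]; ring
      have h6' : (w' tick : ℝ) = (σ i + 1 : ℕ) := by rw [h6]; push_cast; rfl
      refine CanReach.finish hQs (hlt _ _ h.1 (by exact_mod_cast hv))
        (h5.edge hQs (.instr (q := q) (by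
          rw [hq]; exact List.mem_cons_of_mem _ List.mem_cons_self)) rfl ?_) ?_
        (sched_update (fun k => ?_) _ _ h6')
      · simp only [sat_cons, sat_eq, Rel.holds, boundVal, Int.cast_one]
        exact ⟨by rw [h6]; exact hv, hi⟩
      · rw [Function.update_of_ne (reg_ne_tick i).symm, h6]
        exact hv.le
      · rcases lt_or_ge (σ k : ℝ) (σ i + 1) with hk | hk
        · exact .inr (by rw [(h7 k).1 hk, h6])
        · refine .inl ⟨?_, by rwa [h6]⟩
          rw [(h7 k).2 hk, h6]
          rcases h4 k with ⟨h, -⟩ | h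
          · rw [h]; ring
          -- A clock already reset at time `σ i` has `σ k ≤ σ i`, against `hk`.
          · have : (0 : ℝ) ≤ w (reg k) := NNReal.coe_nonneg _
            linarith
  | @copy q q' i j σ hq =>
    right
    obtain ⟨w, h1, h2, h3⟩ := h.reach hQs i
    have hi : (w (reg i) : ℝ) = value v := by rw [(h3 i).2 le_rfl, h2]; ring
    refine CanReach.finish hQs (hlt _ _ h.1 (h.1 i))
      (h1.edge hQs (.instr (q := q) (by rw [hq]; exact List.mem_cons_self)) rfl ?_) ?_
      (sched_update (sched h2 h3) _ _ h2)
    · simp only [sat_cons, sat_eq, Rel.holds, boundVal]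
      exact ⟨by rw [h2]; exact h.1 i, hi⟩
    · rw [Function.update_of_ne (reg_ne_tick j).symm, h2]
      exact (h.1 i).le
  | @test_eq q q₁ q₂ i j σ hq he =>
    right
    dsimp only at h
    obtain ⟨w, h1, h2, h3⟩ := h.reach hQs i
    have hi : (w (reg i) : ℝ) = value v := by rw [(h3 i).2 le_rfl, h2]; ring
    have hj : (w (reg j) : ℝ) = value v := by rw [(h3 j).2 he.le, h2, ← he]; ring
    refine CanReach.finish hQs h.1
      (h1.edge hQs (.instr (q := q) (by rw [hq]; exact List.mem_cons_self)) rfl ?_) ?_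
      (by simpa using sched_update (sched h2 h3) i _ h2)
    · simp only [sat_append, sat_cons, sat_eq, Rel.holds, boundVal]
      exact ⟨⟨by rw [h2]; exact h.1 i, hi⟩, hj⟩
    · rw [Function.update_of_ne (reg_ne_tick i).symm, h2]
      exact (h.1 i).le
  | @test_ne q q₁ q₂ i j σ hq he =>
    right
    dsimp only at h
    obtain ⟨w, h1, h2, h3⟩ := h.reach hQs i
    have hi : (w (reg i) : ℝ) = value v := by rw [(h3 i).2 le_rfl, h2]; ring
    have hσi := h.1 i
    have hσj := h.1 j
    -- At time `σ i` the clock of `j` shows `σ i - σ j` if it was reset earlier, and `p - (σ j - σ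
    -- i)` if it is pending.
    have hj : 0 < (w (reg j) : ℝ) ∧ (w (reg j) : ℝ) < value v := by
      have h0 := (Nat.cast_nonneg (σ j) : (0 : ℝ) ≤ σ j)
      rcases he.lt_or_gt with hij | hij
      · have hij' : (σ i : ℝ) < σ j := by exact_mod_cast hij
        have := (Nat.cast_nonneg (σ i) : (0 : ℝ) ≤ σ i)
        rw [(h3 j).2 hij.le, h2]
        constructor <;> linarith
      · have hij' : (σ j : ℝ) < σ i := by exact_mod_cast hij
        rw [(h3 j).1 hij, h2]
        constructor <;> linarith
    refine CanReach.finish hQs h.1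
      (h1.edge hQs (.instr (q := q) (by
        rw [hq]; exact List.mem_cons_of_mem _ List.mem_cons_self)) rfl ?_) ?_
      (by simpa using sched_update (sched h2 h3) i _ h2)
    · simp only [sat_append, sat_cons, sat_eq, Rel.holds, boundVal, Int.cast_zero]
      exact ⟨⟨by rw [h2]; exact h.1 i, hi⟩, hj.1, hj.2, sat_nil⟩
    · rw [Function.update_of_ne (reg_ne_tick i).symm, h2]
      exact (h.1 i).le

theorem canReach_init (A : PERA (Fin (N + 3)) Loc (Fin 1)) (hA : ∀ l, A.inv l = []) :
    CanReach A v A.init fun _ => 0 :=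
  ⟨_, _, 0, .start (by simp [IsState, hA, Guard.Sat]), by simp⟩

/-- An input `n ≥ p` does not fit into a window; the second entry edge then reports the error. -/
theorem canStart_or_error {Qs : List Q} (hQs : ∀ q, q ∈ Qs) (hv : 0 < value v) :
    (∃ w, CanReach (aut ι Qs M q₀ n) v (ι .error) w) ∨
      CanStart (aut ι Qs M q₀ n) ι v q₀ (Pi.single 0 n) := by
  have h0 : CanReach (aut ι Qs M q₀ n) v (ι .init) fun _ => 0 := canReach_init _ fun _ => rfl
  rcases le_or_gt (value v) n with hn | hn
  · left
    obtain ⟨w, h1, h2, h3⟩ := h0.delay (t := value v) (by simpa using hv.le)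
    refine ⟨_, h1.edge hQs .entryError rfl ?_⟩
    simp only [entryErrorEdge, sat_append, sat_cons, sat_eq, Rel.holds, boundVal, Int.cast_natCast,
      Int.cast_zero]
    exact ⟨⟨by rwa [h2], by rwa [h2], sat_nil⟩, h2⟩
  · right
    obtain ⟨w, h1, h2, h3⟩ := h0.delay (t := n) (by simp)
    have hσ : ∀ k, ((Pi.single 0 n : Fin (N + 1) → ℕ) k : ℝ) < value v := fun k => by
      rcases eq_or_ne k 0 with rfl | hk
      · simpa using hn
      · simpa [hk] using hv
    refine CanReach.finish hQs hσ (h1.edge hQs .entry rfl ?_) ?_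
      (sched_update (σ := 0) (fun k => .inr ?_) 0 n h2)
    · simp only [entryEdge, sat_cons, sat_eq, Rel.holds, boundVal, Int.cast_natCast]
      exact ⟨by rw [h2]; exact hn, h2⟩
    · simp only [entryEdge]
      rw [Function.update_of_ne (reg_ne_tick 0).symm, h2]
      exact hn.le
    · rw [h3, h2]; simp

theorem canStart_of_reach {Qs : List Q} (hQs : ∀ q, q ∈ Qs) (hv : 0 < value v)
    {c : Q × (Fin (N + 1) → ℕ)} (hc : Reach M (q₀, Pi.single 0 n) c) :
    (∃ w, CanReach (aut ι Qs M q₀ n) v (ι .error) w) ∨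
      CanStart (aut ι Qs M q₀ n) ι v c.1 c.2 := by
  induction hc with
  | refl => exact canStart_or_error hQs hv
  | tail _ hs ih => exact ih.elim .inl fun h => CanStart.step hQs h hs

end Completeness

/-! ### Reachability of the error and halting of the machine. -/

/-- The automaton can reach the error under `v`. -/
def ReachesError (ι : SimLoc Q → Loc) (A : PERA (Fin (N + 3)) Loc (Fin 1)) (v : ParamVal (Fin 1)) :
    Prop :=
  ∃ u s, A.FinRun v u s ∧ s.1 = ι .error

section Error

variable {M : Q → Option (Instr Q (Fin (N + 1)))} {q₀ : Q} {n : ℕ} {Qs : List Q}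

/-- For `p = 0` the guard `tick < p` of the entry edge is unsatisfiable, and the entry error edge
requires `p > 0`. -/
theorem not_reachesError_zero (hι : Function.Injective ι) (hQs : ∀ q, q ∈ Qs) :
    ¬ ReachesError ι (aut ι Qs M q₀ n) 0 := by
  rintro ⟨u, s, hs, he⟩
  obtain ⟨l, hl, hw⟩ := Inv.finRun hι hQs (.inr (by simp)) (fun _ _ _ _ _ _ => .inr (by simp)) hs
  obtain rfl := hι (he.symm.trans hl)
  exact hw

/-- The simulation is followed up to an increment of a number that is at least `p`; the error is
reachable there if not before. -/
theorem reachesError_of_unbounded (hQs : ∀ q, q ∈ Qs) (hM : Unbounded M (q₀, Pi.single 0 n))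
    {v : ParamVal (Fin 1)} (hv : v ≠ 0) : ReachesError ι (aut ι Qs M q₀ n) v := by
  have hv0 : 0 < value v := by
    refine Rat.cast_pos.2 (NNRat.coe_pos.2 (pos_iff_ne_zero.2 fun h => hv (funext fun i => ?_)))
    rw [Subsingleton.elim i 0, h, Pi.zero_apply]
  obtain ⟨p, hp⟩ := exists_nat_ge (value v)
  obtain ⟨q, σ, i, q', hr, hq, hi⟩ := hM p
  have : ∃ w, CanReach (aut ι Qs M q₀ n) v (ι .error) w := by
    rcases canStart_of_reach (ι := ι) hQs hv0 hr with h | h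
    · exact h
    · have hi' : (p : ℝ) ≤ σ i := by exact_mod_cast hi
      exact h.error hQs hq (by linarith)
  obtain ⟨_, u, w, d, hu, -⟩ := this
  exact ⟨u, _, hu, rfl⟩

theorem exists_not_reachesError (hι : Function.Injective ι) (hQs : ∀ q, q ∈ Qs)
    (hM : Halts M (q₀, Pi.single 0 n)) :
    ∃ v : ParamVal (Fin 1), v ≠ 0 ∧ ¬ ReachesError ι (aut ι Qs M q₀ n) v := by
  obtain ⟨c, hc, hc'⟩ := hM
  -- A halting computation has finitely many configurations, so `B` bounds all its numbers. The
  -- parameter `B + n + 2` exceeds both the input and every incremented value.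
  obtain ⟨B, hB⟩ := ((hc.finite hc').image fun d => ∑ k, d.2 k).bddAbove
  have hlt : (n : ℝ) < (B + n + 2 : ℕ) := by
    exact_mod_cast (by omega : n < B + n + 2)
  have hval : value (fun _ => ((B + n + 2 : ℕ) : ℚ≥0)) = (B + n + 2 : ℕ) := by simp [value]
  refine ⟨fun _ => ((B + n + 2 : ℕ) : ℚ≥0), fun h => ?_, ?_⟩
  · have := congrFun h 0
    simp only [Pi.zero_apply, Nat.cast_eq_zero] at this
    omega
  · rintro ⟨u, s, hs, he⟩
    obtain ⟨l, hl, hw⟩ := Inv.finRun hι hQs (.inl (by rwa [hval]))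
      (fun q σ i q' hr hq => .inl (by
        rw [hval]
        have h1 : ∑ k, σ k ≤ B := hB ⟨(q, σ), hr, rfl⟩
        have h2 : σ i ≤ ∑ k, σ k :=
          Finset.single_le_sum (fun _ _ => Nat.zero_le _) (Finset.mem_univ i)
        exact_mod_cast (by omega : σ i + 1 < B + n + 2))) hs
    obtain rfl := hι (he.symm.trans hl)
    exact hw

end Error

end Sim

end PERA

/-! ### The three languages in terms of reachability of the error. -/

namespace PERA

open RegMachine

/-- Every state of an infinite run is reached by a finite run. -/
theorem IsInfRun.finRun {Act Loc Par : Type} {A : PERA Act Loc Par} (hA : ∀ l, A.inv l = [])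
    {v : ParamVal Par} {s : ℕ → Loc × ClockVal Act} {d : ℕ → ℝ≥0} {e : ℕ → Edge Act Loc Par}
    (h : A.IsInfRun v s d e) (i : ℕ) : ∃ u, A.FinRun v u (s i) := by
  induction i with
  | zero => exact ⟨[], h.1 ▸ .start (by simp [IsState, hA, Guard.Sat])⟩
  | succ i ih =>
    obtain ⟨u, hu⟩ := ih
    exact ⟨_, hu.snoc (h.2 i)⟩

/-- A finite run can be continued by an infinite sequence of steps. -/
theorem FinRun.exists_isInfRun {Act Loc Par : Type} {A : PERA Act Loc Par} {v : ParamVal Par}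
    {u : List Act} {t : Loc × ClockVal Act} (h : A.FinRun v u t)
    (s : ℕ → Loc × ClockVal Act) (d : ℕ → ℝ≥0) (e : ℕ → Edge Act Loc Par) (h0 : s 0 = t)
    (hs : ∀ i, A.Step v (s i) (d i) (e i) (s (i + 1))) :
    ∃ s' d' e', A.IsInfRun v s' d' e' ∧ ∃ k, ∀ i, e' (k + i) = e i := by
  induction h generalizing s d e with
  | start => exact ⟨s, d, e, ⟨h0, hs⟩, 0, fun i => by rw [Nat.zero_add]⟩
  -- The last step of the finite run is moved to the front of the infinite sequence.
  | @snoc u t t' d₀ e₀ _ hst ih =>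
    obtain ⟨s', d', e', hr, k, hk⟩ := ih (fun i => i.casesOn t s) (fun i => i.casesOn d₀ d)
      (fun i => i.casesOn e₀ e) rfl (fun i => by
        cases i with
        | zero => simpa [h0] using hst
        | succ i => exact hs i)
    exact ⟨s', d', e', hr, k + 1, fun i => by rw [Nat.add_assoc, Nat.add_comm 1, hk]⟩

/-- The reference valuation itself has the language `B`, so preservation asks for another valuation
with language `B`. -/
theorem preserved_iff {Par W : Type} {UL : ParamVal Par → Set W} {v₀ : ParamVal Par} {B : Set W}
    {P : ParamVal Par → Prop} (h : ∀ v, UL v = B ↔ ¬ P v) (h₀ : ¬ P v₀) :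
    Preserved UL v₀ ↔ ∃ v, v ≠ v₀ ∧ ¬ P v := by
  simp only [Preserved, (h v₀).2 h₀, h]

namespace Sim

section Languages

variable {N : ℕ} {Q Loc : Type} {ι : SimLoc Q → Loc} {M : Q → Option (Instr Q (Fin (N + 1)))}
  {q₀ : Q} {n : ℕ} {Qs : List Q} {v : ParamVal (Fin 1)}

/-- Only the edges to the error location read the action `err`. -/
theorem IsEdge.tgt_eq {e : Edge (Fin (N + 3)) Loc (Fin 1)} (he : IsEdge ι M q₀ n e)
    (ha : e.act = err) : e.tgt = ι .error := by
  have h0 : (tick : Fin (N + 3)) ≠ err := by simp [tick, err]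
  cases he with
  | entry => exact absurd ha (reg_ne_err 0)
  | entryError => rfl
  | error => rfl
  | init h => exact absurd ha h
  | free h => exact absurd ha h
  | reset => exact absurd ha (reg_ne_err _)
  | window => exact absurd ha h0
  | @instr q _ he =>
    match hq : M q with
    | none => simp [hq, instrEdges] at he
    | some (.zero j q') =>
      simp only [hq, instrEdges, List.mem_singleton] at he
      subst he
      exact absurd ha (reg_ne_err _)
    | some (.copy i j q') =>
      simp only [hq, instrEdges, List.mem_singleton] at he
      subst he
      exact absurd ha (reg_ne_err _)
    | some (.test i j q₁ q₂) =>
      simp only [hq, instrEdges, List.mem_pair] at he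
      rcases he with rfl | rfl <;> exact absurd ha (reg_ne_err _)
    | some (.succ i q') =>
      simp only [hq, instrEdges, List.mem_cons, List.not_mem_nil, or_false] at he
      rcases he with rfl | rfl | rfl
      · exact absurd ha (reg_ne_err _)
      · exact absurd ha (reg_ne_err _)
      · rfl

theorem step_tgt (hQs : ∀ q, q ∈ Qs) {s s' : Loc × ClockVal (Fin (N + 3))} {d : ℝ≥0}
    {e : Edge (Fin (N + 3)) Loc (Fin 1)} (h : (aut ι Qs M q₀ n).Step v s d e s')
    (ha : e.act = err) : s'.1 = ι .error := by
  obtain ⟨h1, -, -, rfl⟩ := (step_iff fun _ => rfl).1 h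
  exact ((mem_edges hQs).1 h1).tgt_eq ha

theorem step_error (hQs : ∀ q, q ∈ Qs) (w : ClockVal (Fin (N + 3))) :
    (aut ι Qs M q₀ n).Step v (ι .error, w) 0 ⟨ι .error, [], err, ι .error⟩
      (ι .error, Function.update w err 0) :=
  (step_iff fun _ => rfl).2 ⟨(mem_edges hQs).2 .error, rfl, sat_nil, by simp⟩

theorem step_free (hQs : ∀ q, q ∈ Qs) {l : SimLoc Q} (hl : l = .init ∨ l = .free)
    {a : Fin (N + 3)} (ha : a ≠ err) :
    (aut ι Qs M q₀ n).Step v (ι l, fun _ => 0) 0 ⟨ι l, [], a, ι .free⟩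
      (ι .free, fun _ => 0) := by
  refine (step_iff fun _ => rfl).2 ⟨(mem_edges hQs).2 ?_, rfl, sat_nil, ?_⟩
  · rcases hl with rfl | rfl
    exacts [.init ha, .free ha]
  · simp only [add_zero]
    exact Prod.ext rfl (Function.update_eq_self a _).symm

theorem exists_finRun_of_not_mem (hQs : ∀ q, q ∈ Qs) (u : List (Fin (N + 3))) (hu : err ∉ u) :
    ∃ l, (l = SimLoc.init ∨ l = .free) ∧
      (aut ι Qs M q₀ n).FinRun v u (ι l, fun _ => 0) := by
  induction u using List.reverseRecOn with
  | nil => exact ⟨.init, .inl rfl, .start (by simp [IsState, aut, Guard.Sat])⟩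
  | append_singleton u a ih =>
    simp only [List.mem_append, List.mem_singleton, not_or] at hu
    obtain ⟨l, hl, h⟩ := ih hu.1
    exact ⟨.free, .inr rfl, h.snoc (step_free hQs hl (Ne.symm hu.2))⟩

/-- Words without `err` are read under every valuation by the free component without delay. A run in
the error location can read `err`, and reading `err` always leads there. -/
theorem safetyLang_eq_iff (hQs : ∀ q, q ∈ Qs) :
    (aut ι Qs M q₀ n).safetyLang v = {u | err ∉ u} ↔ ¬ ReachesError ι (aut ι Qs M q₀ n) v := by
  constructor
  · rintro h ⟨u, ⟨l, w⟩, hu, rfl⟩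
    have : u ++ [err] ∈ (aut ι Qs M q₀ n).safetyLang v := ⟨_, hu.snoc (step_error hQs w)⟩
    rw [h] at this
    exact this (by simp)
  · intro h
    ext u
    constructor
    · rintro ⟨s, hs⟩
      induction hs with
      | start => exact List.not_mem_nil
      | @snoc u s s' d e hu hst ih =>
        intro hm
        rcases List.mem_append.1 hm with hm | hm
        · exact ih hm
        · exact h ⟨_, _, hu.snoc hst, step_tgt hQs hst (List.mem_singleton.1 hm).symm⟩
    · intro hu
      obtain ⟨l, -, hl⟩ := exists_finRun_of_not_mem hQs u hu
      exact ⟨_, hl⟩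

theorem reachLang_eq_iff (hQs : ∀ q, q ∈ Qs) {F : List Loc} (hF : ∀ l, l ∈ F) :
    (aut ι Qs M q₀ n).reachLang F v = {u | err ∉ u} ↔
      ¬ ReachesError ι (aut ι Qs M q₀ n) v := by
  rw [← safetyLang_eq_iff hQs, show (aut ι Qs M q₀ n).reachLang F v =
    (aut ι Qs M q₀ n).safetyLang v from
      Set.ext fun _ => exists_congr fun s => and_iff_left (hF s.1)]

/-- With all locations accepting, every infinite run counts. A run to the error extends to an
infinite one by the loop on `err`, without delay. -/
theorem buchiLang_eq_iff (hQs : ∀ q, q ∈ Qs) {F : List Loc} (hF : ∀ l, l ∈ F) :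
    (aut ι Qs M q₀ n).buchiLang F v = {u | ∀ i, u i ≠ err} ↔
      ¬ ReachesError ι (aut ι Qs M q₀ n) v := by
  have hinf : ∀ s : ℕ → Loc × ClockVal (Fin (N + 3)), {i | (s i).1 ∈ F}.Infinite := fun s => by
    simpa [hF] using Set.infinite_univ
  constructor
  · rintro h ⟨u, ⟨l, w⟩, hu, rfl⟩
    obtain ⟨s', d', e', hr, k, hk⟩ := hu.exists_isInfRun
      (fun i => (ι .error, (fun w => Function.update w err 0)^[i] w)) (fun _ => 0)
      (fun _ => ⟨ι .error, [], err, ι .error⟩) rfl (fun i => by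
        simp only [Function.iterate_succ_apply']
        exact step_error hQs _)
    have : (fun i => (e' i).act) ∈ (aut ι Qs M q₀ n).buchiLang F v :=
      ⟨s', d', e', hr, fun _ => rfl, hinf _⟩
    rw [h] at this
    exact this k (by simpa using congrArg Edge.act (hk 0))
  · intro h
    ext u
    constructor
    · rintro ⟨s, d, e, hr, hu, -⟩ i hi
      obtain ⟨u', hu'⟩ := hr.finRun (fun _ => rfl) (i + 1)
      exact h ⟨u', _, hu', step_tgt hQs (hr.2 i) ((hu i).symm.trans hi)⟩
    · intro hu
      let l : ℕ → SimLoc Q := fun i => i.casesOn .init fun _ => .free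
      refine ⟨fun i => (ι (l i), fun _ => 0), fun _ => 0, fun i => ⟨ι (l i), [], u i, ι .free⟩,
        ⟨rfl, fun i => step_free hQs ?_ (hu i)⟩, fun _ => rfl, hinf _⟩
      cases i
      exacts [.inl rfl, .inr rfl]

end Languages

/-! ### Finiteness and computability of the reduction. -/

instance {Q : Type} [Finite Q] : Finite (SimLoc Q) := by
  let f : SimLoc Q → Fin 3 ⊕ Q ⊕ Q ⊕ Q
    | .init => .inl 0
    | .free => .inl 1
    | .error => .inl 2
    | .start q => .inr (.inl q)
    | .mid q => .inr (.inr (.inl q))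
    | .done q => .inr (.inr (.inr q))
  refine Finite.of_injective f fun a b h => ?_
  cases a <;> cases b <;> simp_all [f]

/-- The encoding of the integer `n` is `2 * n`. -/
theorem primrec_intCast : Primrec fun n : ℕ => (n : ℤ) :=
  Primrec.encode_iff.1 ((Primrec.nat_mul.comp (.const 2) .id).of_eq fun _ => rfl)

/-- The description of the automaton is computable from the input. -/
theorem primrec_code {N m : ℕ} {Q : Type} (ι : SimLoc Q → Fin m) (Qs : List Q)
    (M : Q → Option (Instr Q (Fin (N + 1)))) (q₀ : Q) :
    Primrec fun n => (aut ι Qs M q₀ n).code := by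
  have bound : Primrec fun n : ℕ => (Sum.inr (n : ℤ) : ℕ ⊕ ℤ) :=
    Primrec.sumInr.comp primrec_intCast
  have atom : ∀ x r : ℕ, Primrec fun n : ℕ => (x, r, (Sum.inr (n : ℤ) : ℕ ⊕ ℤ)) := fun x r =>
    (Primrec.const x).pair ((Primrec.const r).pair bound)
  have entry : Primrec fun n => Edge.code (entryEdge (N := N) ι q₀ n) := by
    change Primrec fun n : ℕ => ((ι .init).val,
      ([(0, 0, .inl 0), (0, 1, .inr (n : ℤ)), (0, 2, .inr (n : ℤ))] : GuardCode),
      (reg (0 : Fin (N + 1))).val, (ι (.done q₀)).val)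
    exact (Primrec.const _).pair (Primrec.pair (Primrec.list_cons.comp (.const _)
      (Primrec.list_cons.comp (atom _ _) (Primrec.list_cons.comp (atom _ _) (.const []))))
      (.const _))
  have entryError : Primrec fun n => Edge.code (entryErrorEdge (N := N) ι n) := by
    change Primrec fun n : ℕ => ((ι .init).val,
      ((0, 1, .inr (n : ℤ)) :: [(0, 3, .inr 0), (0, 1, .inl 0), (0, 2, .inl 0)] : GuardCode),
      (err : Fin (N + 3)).val, (ι .error).val)
    exact (Primrec.const _).pair (Primrec.pair (Primrec.list_cons.comp (atom _ _)
      (.const _)) (.const _))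
  -- Only the two entry edges depend on the input; everything else is constant.
  change Primrec fun n : ℕ => ((N + 3, m, 1), (ι .init).val,
    List.ofFn (fun _ : Fin m => ([] : GuardCode)),
    Edge.code (entryEdge (N := N) ι q₀ n) :: Edge.code (entryErrorEdge (N := N) ι n) ::
      (coreEdges ι Qs M).map Edge.code)
  exact (Primrec.const _).pair ((Primrec.const _).pair ((Primrec.const _).pair
    (Primrec.list_cons.comp entry (Primrec.list_cons.comp entryError (.const _)))))

end Sim

/-- A primitive recursive predicate whose search problem is the halting problem. -/
theorem exists_primrec_halting : ∃ T : ℕ → ℕ → ℕ, Primrec₂ T ∧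
    ∀ c : Nat.Partrec.Code, (∃ k, T (Encodable.encode c) k = 0) ↔ (c.eval 0).Dom := by
  refine ⟨fun n k => if ((Denumerable.ofNat Nat.Partrec.Code n).evaln k 0).isSome then 0 else 1,
    ?_, fun c => ?_⟩
  · have : Primrec fun a : ℕ × ℕ => (Denumerable.ofNat Nat.Partrec.Code a.1).evaln a.2 0 :=
      Nat.Partrec.Code.primrec_evaln.comp
        ((Primrec.snd.pair ((Primrec.ofNat _).comp .fst)).pair (.const 0))
    exact Primrec.ite (Primrec.eq.comp (Primrec.option_isSome.comp this) (.const true)) (.const 0)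
      (.const 1)
  · simp only [Denumerable.ofNat_encode, Part.dom_iff_mem, Nat.Partrec.Code.evaln_complete]
    simp only [ite_eq_left_iff, one_ne_zero, imp_false, not_not, Option.isSome_iff_exists,
      Option.mem_def]
    exact exists_comm

/-- The halting problem reduces to the question whether some valuation other than `0` avoids the
error. -/
theorem exists_reduction : ∃ (n m : ℕ) (A : Nat.Partrec.Code → PERA (Fin n) (Fin m) (Fin 1)),
    Computable (fun c => (A c).code) ∧ ∀ c,
      (Preserved ((A c).buchiLang (List.finRange m)) 0 ↔ (c.eval 0).Dom) ∧
      (Preserved ((A c).reachLang (List.finRange m)) 0 ↔ (c.eval 0).Dom) ∧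
      (Preserved (A c).safetyLang 0 ↔ (c.eval 0).Dom) := by
  obtain ⟨T, hT, hTc⟩ := exists_primrec_halting
  obtain ⟨L, N, M, hM⟩ := exists_search_machine hT
  obtain ⟨m, ⟨ι⟩⟩ := Finite.exists_equiv_fin (SimLoc (Fin (L + 1)))
  have hQs : ∀ q, q ∈ List.finRange (L + 1) := List.mem_finRange
  have hF : ∀ l, l ∈ List.finRange m := List.mem_finRange
  refine ⟨N + 3, m, fun c => Sim.aut ι (List.finRange (L + 1)) M 0 (Encodable.encode c),
    ((Sim.primrec_code ι _ M 0).comp Primrec.encode).to_comp, fun c => ?_⟩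
  have h0 := Sim.not_reachesError_zero (M := M) (q₀ := 0) (n := Encodable.encode c) ι.injective hQs
  have key : (∃ v, v ≠ 0 ∧ ¬ Sim.ReachesError ι
      (Sim.aut ι (List.finRange (L + 1)) M 0 (Encodable.encode c)) v) ↔ (c.eval 0).Dom := by
    rw [← hTc]
    constructor
    · rintro ⟨v, hv, hn⟩
      -- If the search fails, its counter is unbounded and every positive parameter admits the
      -- error.
      by_contra! hk
      exact hn (Sim.reachesError_of_unbounded hQs ((hM _).2 hk) hv)
    · exact fun hk => Sim.exists_not_reachesError ι.injective hQs ((hM _).1 hk)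
  dsimp only
  exact ⟨(preserved_iff (UL := PERA.buchiLang _ _)
      (fun v => Sim.buchiLang_eq_iff hQs hF) h0).trans key,
    (preserved_iff (UL := PERA.reachLang _ _) (fun v => Sim.reachLang_eq_iff hQs hF) h0).trans key,
    (preserved_iff (UL := PERA.safetyLang _) (fun v => Sim.safetyLang_eq_iff hQs) h0).trans key⟩

theorem not_computablePred_of_reduction {α : Type} [Primcodable α] {D : α → Prop}
    {f : Nat.Partrec.Code → α} (hf : Computable f) (h : ∀ c, D (f c) ↔ (c.eval 0).Dom) :
    ¬ ComputablePred D := fun hD =>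
  ComputablePred.halting_problem 0
    (ComputablePred.computable_of_manyOneReducible ⟨f, hf, fun c => (h c).symm⟩ hD)

end PERA

theorem mainTheorem2 :
    ¬ PERA.DecidableProblemAcc (fun _ _ _ A F v₀ => PERA.Preserved (A.buchiLang F) v₀) ∧
    ¬ PERA.DecidableProblemAcc (fun _ _ _ A F v₀ => PERA.Preserved (A.reachLang F) v₀) ∧
    ¬ PERA.DecidableProblem (fun _ _ _ A v₀ => PERA.Preserved A.safetyLang v₀) := by
  obtain ⟨n, m, A, hA, h⟩ := PERA.exists_reduction
  refine ⟨?_, ?_, ?_⟩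
  · rintro ⟨D, hD, hDA⟩
    exact PERA.not_computablePred_of_reduction
      (hA.pair ((Computable.const ((List.finRange m).map Fin.val)).pair
        (Computable.const (PERA.valCode (0 : PERA.ParamVal (Fin 1))))))
      (fun c => (hDA n m 1 (A c) _ 0).trans (h c).1) hD
  · rintro ⟨D, hD, hDA⟩
    exact PERA.not_computablePred_of_reduction
      (hA.pair ((Computable.const ((List.finRange m).map Fin.val)).pair
        (Computable.const (PERA.valCode (0 : PERA.ParamVal (Fin 1))))))
      (fun c => (hDA n m 1 (A c) _ 0).trans (h c).2.1) hD
  · rintro ⟨D, hD, hDA⟩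
    exact PERA.not_computablePred_of_reduction
      (hA.pair (Computable.const (PERA.valCode (0 : PERA.ParamVal (Fin 1)))))
      (fun c => (hDA n m 1 (A c) 0).trans (h c).2.2) hD
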